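/- **Conventions.** For a one-dimensional Cohen–Macaulay (Noetherian) local ring $(A,\mathfrak n)$, a canonical module $\mathrm K_A$ is a maximal Cohen–Macaulay module of finite injective dimension and type one, and a canonical ideal is an ideal $I\neq A$ with $I\cong \mathrm K_A$. The ring $A$ is *almost Gorenstein* (AGL) if there is an exact sequence $0\to A\to \mathrm K_A\to C\to 0$ of $A$-modules with $\mathfrak nC=(0)$. The ring $A$ is *$2$-almost Gorenstein* ($2$-AGL) if it has a canonical ideal $I$ containing a parameter ideal $Q=(a)$ as a reduction such that the Sally module $\mathcal S_Q(I)=I\,A[It]/I\,\mathcal T$, where $\mathcal T=A[Qt]$, has rank two, that is, $\ell_{\mathcal T_{\mathfrak p}}\big(\mathcal S_Q(I)_{\mathfrak p}\big)=2$ for the prime ideal $\mathfrak p=\mathfrak n\mathcal T$ (this rank does not depend on the choice of $I$ and $Q$). Here $\ell$ denotes length. A local ring is Gorenstein if it is Noetherian and has finite injective dimension over itself. **Theorem 5.2.** Let $(R,\mathfrak m)$ and $(R_1,\mathfrak m_1)$ be Cohen–Macaulay local rings of dimension one, and suppose that $R$ has a canonical ideal which contains a parameter ideal of $R$ as a reduction.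 Let $R\to R_1$ be a flat local homomorphism such that $R_1/\mathfrak mR_1$ is a Gorenstein ring. Then the following conditions are equivalent. 1. $R_1$ is a $2$-AGL ring. 2. Either (i) $R$ is an AGL ring but not a Gorenstein ring, and $\ell_{R_1}(R_1/\mathfrak mR_1)=2$, or (ii) $R$ is a $2$-AGL ring and $\mathfrak mR_1=\mathfrak m_1$. -/

import Mathlib

open IsLocalRing Polynomial CategoryTheory

universe u v

/-- `(R, m)` is a Cohen-Macaulay (Noetherian) local ring of Krull dimension one: there is an
`R`-regular sequence whose length is `dim R`. -/
class IsOneDimCMLocalRing (R : Type u) [CommRing R] : Prop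
    extends IsLocalRing R, IsNoetherianRing R where
  ringKrullDim_eq_one : ringKrullDim R = 1
  exists_isRegular : ∃ rs : List R, RingTheory.Sequence.IsRegular R rs ∧
    (rs.length : WithBot ℕ∞) = ringKrullDim R

/-- A Gorenstein local ring: a Noetherian local ring of finite self-injective dimension. -/
structure IsGorensteinLocalRing (R : Type u) [CommRing R] : Prop where
  isLocalRing : IsLocalRing R
  isNoetherianRing : IsNoetherianRing R
  injectiveDimension_lt_top : injectiveDimension (ModuleCat.of R R) < ⊤

/-- A canonical module of a Cohen-Macaulay local ring `R`: a maximal Cohen-Macaulay module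
(finitely generated, with a regular sequence of length `d = dim R`), of type one
(`Ext^d(R/m, M)` has length one) and of finite injective dimension. -/
structure IsCanonicalModule (R : Type u) [CommRing R] [IsLocalRing R]
    (M : Type u) [AddCommGroup M] [Module R M] : Prop where
  finite : Module.Finite R M
  exists_isRegular_and_length_ext : ∃ rs : List R, RingTheory.Sequence.IsRegular M rs ∧
    (rs.length : WithBot ℕ∞) = ringKrullDim R ∧
    Module.length R
      (Abelian.Ext (ModuleCat.of R (R ⧸ maximalIdeal R)) (ModuleCat.of R M) rs.length) = 1
  injectiveDimension_lt_top : injectiveDimension (ModuleCat.of R M) < ⊤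

/-- A canonical ideal: a proper ideal that is, as a module, a canonical module. -/
structure IsCanonicalIdeal {R : Type u} [CommRing R] [IsLocalRing R] (I : Ideal R) : Prop where
  ne_top : I ≠ ⊤
  isCanonicalModule : IsCanonicalModule R I

/-- `J` is a reduction of `I`. -/
def IsReductionOf {R : Type u} [CommRing R] (J I : Ideal R) : Prop :=
  J ≤ I ∧ ∃ n : ℕ, I ^ (n + 1) = J * I ^ n

/-- `a` generates a parameter ideal of a one-dimensional local ring: `(a)` is `m`-primary. -/
def IsParameter {R : Type u} [CommRing R] [IsLocalRing R] (a : R) : Prop :=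
  (Ideal.span {a}).radical = maximalIdeal R

/-- `R` is almost Gorenstein: there is an exact sequence `0 → R → K → C → 0` with `K` a canonical
module and `m C = 0`. -/
def IsAGL (R : Type u) [CommRing R] [IsLocalRing R] : Prop :=
  ∃ (K : Type u) (_ : AddCommGroup K) (_ : Module R K)
    (C : Type u) (_ : AddCommGroup C) (_ : Module R C) (f : R →ₗ[R] K) (g : K →ₗ[R] C),
    IsCanonicalModule R K ∧
    Function.Injective f ∧ Function.Exact f g ∧ Function.Surjective g ∧
    maximalIdeal R • (⊤ : Submodule R C) = ⊥

section SallyModule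

variable {R : Type u} [CommRing R]

/-- `I R[It]`, as a submodule of `R[t]` over the Rees algebra `T = R[at]` of `(a)`. When `a ∈ I`,
the span over `T` is the same as the ideal of `R[It]` generated by `I`. -/
noncomputable def reesNumerator (I : Ideal R) (a : R) :
    Submodule (reesAlgebra (Ideal.span {a})) R[X] :=
  Submodule.span _ {h | ∃ x ∈ I, ∃ f ∈ reesAlgebra I, h = C x * f}

/-- `I T`, as a submodule of `R[t]` over the Rees algebra `T = R[at]` of `(a)`. -/
noncomputable def reesDenominator (I : Ideal R) (a : R) :
    Submodule (reesAlgebra (Ideal.span {a})) R[X] :=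
  Submodule.span _ {h | ∃ x ∈ I, h = C x}

/-- The quotient `N / (N ∩ P)` of submodules of a module. -/
abbrev Submodule.Subquotient {T : Type*} {M : Type*} [Ring T] [AddCommGroup M] [Module T M]
    (N P : Submodule T M) : Type _ :=
  N ⧸ P.submoduleOf N

/-- The Sally module `I R[It] / I R[at]` of `I` with respect to `(a)`, over `T = R[at]`. -/
abbrev SallyModule (I : Ideal R) (a : R) : Type u :=
  Submodule.Subquotient (reesNumerator I a) (reesDenominator I a)

/-- The ideal `m T` of the Rees algebra `T = R[at]`. -/
noncomputable def sallyPrime [IsLocalRing R] (a : R) : Ideal (reesAlgebra (Ideal.span {a})) :=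
  (maximalIdeal R).map (algebraMap R (reesAlgebra (Ideal.span {a})))

theorem IsParameter.not_isNilpotent [IsOneDimCMLocalRing R] {a : R} (ha : IsParameter a) :
    ¬ IsNilpotent a := by
  intro hn
  have hm : maximalIdeal R ≤ nilradical R := by
    rw [← (show (Ideal.span {a}).radical = maximalIdeal R from ha)]
    refine (Ideal.radical_mono (I := Ideal.span {a}) (J := nilradical R) ?_).trans
      (Ideal.radical_idem _).le
    rw [Ideal.span_singleton_le_iff_mem]
    exact mem_nilradical.mpr hn
  have : Ring.KrullDimLE 0 R := by
    refine Ring.krullDimLE_zero_iff.mpr fun P hP => ?_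
    have hle : maximalIdeal R ≤ P := hm.trans (nilradical_le_prime P)
    rw [le_antisymm (le_maximalIdeal hP.ne_top) hle]
    exact maximalIdeal.isMaximal R
  have h0 : ringKrullDim R ≤ 0 := Ring.krullDimLE_iff.mp this
  rw [IsOneDimCMLocalRing.ringKrullDim_eq_one] at h0
  exact absurd h0 (by decide)

theorem sallyPrime_isPrime [IsLocalRing R] {a : R} (ha : ¬ IsNilpotent a) :
    (sallyPrime a).IsPrime := by
  let y : reesAlgebra (Ideal.span {a}) :=
    ⟨monomial 1 a, reesAlgebra.monomial_mem.mpr (by simp)⟩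
  let ψ : R[X] →ₐ[R] reesAlgebra (Ideal.span {a}) := aeval y
  have hcoe : ∀ f : R[X], ∀ n, ((ψ f : R[X])).coeff n = f.coeff n * a ^ n := by
    intro f n
    have h1 : ((ψ f : reesAlgebra (Ideal.span {a})) : R[X]) = aeval (monomial 1 a : R[X]) f :=
      (Polynomial.aeval_algHom_apply (reesAlgebra (Ideal.span {a})).val y f).symm
    rw [h1, aeval_eq_sum_range]
    simp only [monomial_pow, one_mul, finsetSum_coeff, coeff_smul, coeff_monomial, smul_eq_mul,
      mul_ite, mul_zero, Finset.sum_ite_eq', Finset.mem_range]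
    split_ifs with h
    · rfl
    · rw [coeff_eq_zero_of_natDegree_lt (by omega), zero_mul]
  have hsurj : Function.Surjective ψ := by
    intro g
    have hg : ∀ n, ∃ r : R, (g : R[X]).coeff n = r * a ^ n := fun n => by
      have := g.2 n
      rw [Ideal.span_singleton_pow, Ideal.mem_span_singleton'] at this
      obtain ⟨r, hr⟩ := this
      exact ⟨r, hr.symm⟩
    choose r hr using hg
    refine ⟨∑ n ∈ (g : R[X]).support, monomial n (r n), Subtype.ext ?_⟩
    ext n
    rw [hcoe]
    simp only [finsetSum_coeff, coeff_monomial, Finset.sum_ite_eq', mem_support_iff]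
    split_ifs with h
    · exact (hr n).symm
    · rw [zero_mul]
      exact (notMem_support_iff.mp (by simpa using h)).symm
  have hker : RingHom.ker ψ ≤ (maximalIdeal R).map C := by
    intro f hf
    rw [Ideal.mem_map_C_iff]
    intro n
    have h0 : f.coeff n * a ^ n = 0 := by
      rw [← hcoe, (RingHom.mem_ker).mp hf]
      simp
    by_contra hu
    have hu' : IsUnit (f.coeff n) := by simpa using hu
    exact ha ⟨n, (hu'.mul_right_eq_zero).mp h0⟩
  have hP : ((maximalIdeal R).map (C : R →+* R[X])).IsPrime := Ideal.isPrime_map_C_of_isPrime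
  have hc : algebraMap R (reesAlgebra (Ideal.span {a})) = (ψ.toRingHom).comp C :=
    ψ.comp_algebraMap.symm
  rw [sallyPrime, hc, ← Ideal.map_map]
  exact Ideal.map_isPrime_of_surjective (f := ψ.toRingHom) hsurj hker

/-- The rank of the Sally module: the length of its localization at `m T`, over `T_{m T}`. -/
noncomputable def sallyRank [IsOneDimCMLocalRing R] (I : Ideal R) (a : R) (ha : IsParameter a) :
    ℕ∞ :=
  haveI : (sallyPrime a).IsPrime := sallyPrime_isPrime ha.not_isNilpotent
  Module.length (Localization.AtPrime (sallyPrime a))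
    (LocalizedModule (sallyPrime a).primeCompl (SallyModule I a))

end SallyModule

/-- `R` has a canonical ideal that contains a parameter ideal as a reduction. -/
def HasReducedCanonicalIdeal (R : Type u) [CommRing R] [IsLocalRing R] : Prop :=
  ∃ (I : Ideal R) (a : R), IsCanonicalIdeal I ∧ IsParameter a ∧ IsReductionOf (Ideal.span {a}) I

/-- `R` is 2-almost Gorenstein: the Sally module of a canonical ideal with respect to a parameter
ideal that is a reduction of it has rank two. (The rank does not depend on the choices.) -/
def IsTwoAGL (R : Type u) [CommRing R] [IsOneDimCMLocalRing R] : Prop :=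
  ∃ (I : Ideal R) (a : R) (ha : IsParameter a),
    IsCanonicalIdeal I ∧ IsReductionOf (Ideal.span {a}) I ∧ sallyRank I a ha = 2

/-! ### Parameters and nonzerodivisors in dimension one. -/

section OneDimensional

variable {A : Type u} [CommRing A]

/-! Let `I` be a canonical ideal with parameter reduction `(a)`, so `I ^ (n + 1) = a I ^ n` for some
`n`. Localization at `p = mT` inverts `at`, and the Sally module becomes the base change to `T_p` of
its graded piece `V = I ^ (n + 1) / a ^ n I`. Since `T_p` is flat over the base with maximal ideal
`mT_p`, the rank equals the length of `V`, which is `sallyLength` (`sallyRank_eq_sallyLength`). This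
length is a combination of colengths, so a flat local map to `R₁` multiplies it by `ℓ(R₁ / mR₁)`
(`sallyLength_map`). The ideal `IR₁` is again canonical because the fiber is Gorenstein, and the
rank does not depend on the canonical ideal (`isTwoAGL_iff_sallyLength_eq_two`). Hence `R₁` is 2-AGL
iff `ℓ(V) * ℓ(R₁ / mR₁) = 2`. The factorizations `1 * 2` and `2 * 1` are the two alternatives, since
`ℓ(V) = 1` means almost Gorenstein and not Gorenstein (`sallyLength_eq_one_iff`).

Canonical ideals are handled through the elementary condition `Ideal.IsTypeOne`: `J / cJ` has simple
socle. If `J` contains a nonzerodivisor, `J / cJ` and `A / c` have equal length, and counting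
lengths shows that maps from ideals of `A / c` to `J / cJ` are multiplications by elements. This
replaces Matlis duality. It yields uniqueness up to a fractional multiple
(`Ideal.IsTypeOne.exists_mul_eq_mul`), faithfulness of `J / cJ` over `A / c`, and finite injective
dimension (`Ideal.IsTypeOne.injectiveDimension_lt_top`). Type one passes to `R₁` by a socle
computation (`HasSimpleSocle.baseChange`). -/

theorem isSMulRegular_of_mem_nonZeroDivisors {b : A} (hb : b ∈ nonZeroDivisors A) :
    IsSMulRegular A b := by
  intro x y h
  exact (mul_cancel_left_mem_nonZeroDivisors hb).mp h

theorem isSMulRegular_ideal_of_mem_nonZeroDivisors {b : A} (hb : b ∈ nonZeroDivisors A)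
    (J : Ideal A) : IsSMulRegular J b :=
  (isSMulRegular_of_mem_nonZeroDivisors hb).submodule J b

theorem RingTheory.Sequence.IsRegular.mem_maximalIdeal_and_isSMulRegular [IsLocalRing A]
    {M : Type*} [AddCommGroup M] [Module A M] {r : A}
    (h : RingTheory.Sequence.IsRegular M [r]) : r ∈ maximalIdeal A ∧ IsSMulRegular M r := by
  refine ⟨?_, ?_⟩
  · by_contra hr
    have hu : IsUnit r := by simpa using hr
    apply h.top_ne_smul
    rw [Ideal.ofList_singleton, Ideal.span_singleton_eq_top.mpr hu, Submodule.top_smul]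
  · exact ((RingTheory.Sequence.isWeaklyRegular_cons_iff M r []).mp h.toIsWeaklyRegular).1

instance [IsOneDimCMLocalRing A] : Ring.KrullDimLE 1 A :=
  Ring.krullDimLE_iff.mpr (by rw [IsOneDimCMLocalRing.ringKrullDim_eq_one]; rfl)

theorem length_eq_one_of_cast_eq_ringKrullDim [IsOneDimCMLocalRing A] {rs : List A}
    (h : (rs.length : WithBot ℕ∞) = ringKrullDim A) : ∃ r, rs = [r] := by
  rw [IsOneDimCMLocalRing.ringKrullDim_eq_one] at h
  exact List.length_eq_one_iff.mp (by exact_mod_cast h)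

theorem IsParameter.mem_maximalIdeal [IsLocalRing A] {a : A} (ha : IsParameter a) :
    a ∈ maximalIdeal A := by
  rw [← show (Ideal.span {a}).radical = maximalIdeal A from ha]
  exact Ideal.le_radical (Ideal.mem_span_singleton_self a)

theorem IsParameter.isSMulRegular [IsLocalRing A] {M : Type*} [AddCommGroup M] [Module A M]
    {a r : A} (ha : IsParameter a) (hr : r ∈ maximalIdeal A) (h : IsSMulRegular M r) :
    IsSMulRegular M a := by
  rw [← show (Ideal.span {a}).radical = maximalIdeal A from ha] at hr
  obtain ⟨n, hn⟩ := hr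
  obtain ⟨c, hc⟩ := Ideal.mem_span_singleton'.mp hn
  have h' := h.pow n
  rw [← hc] at h'
  exact IsSMulRegular.of_mul h'

variable [IsOneDimCMLocalRing A]

theorem IsParameter.mem_nonZeroDivisors {a : A} (ha : IsParameter a) :
    a ∈ nonZeroDivisors A := by
  obtain ⟨rs, hrs, hl⟩ := IsOneDimCMLocalRing.exists_isRegular (R := A)
  obtain ⟨r, rfl⟩ := length_eq_one_of_cast_eq_ringKrullDim hl
  obtain ⟨hr, hr'⟩ := hrs.mem_maximalIdeal_and_isSMulRegular
  have := ha.isSMulRegular hr hr'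
  rw [mem_nonZeroDivisors_iff_right]
  intro x hx
  refine this ?_
  simpa [mul_comm] using hx

theorem isParameter_of_mem_nonZeroDivisors {a : A} (ha : a ∈ nonZeroDivisors A)
    (ham : a ∈ maximalIdeal A) : IsParameter a := by
  refine le_antisymm ((maximalIdeal.isMaximal A).isPrime.radical_le_iff.mpr
    ((Ideal.span_singleton_le_iff_mem _).mpr ham)) fun x hx => ?_
  have hd : Ring.KrullDimLE 0 (A ⧸ Ideal.span {a}) := by
    rw [Ring.KrullDimLE, Order.krullDimLE_iff,
      ← ENat.WithBot.add_le_add_one_right_iff, Nat.cast_zero, zero_add]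
    exact (ringKrullDim_quotient_succ_le_of_nonZeroDivisor ha).trans
      (Order.KrullDimLE.krullDim_le)
  have hne : Ideal.span {a} ≠ ⊤ := by
    rw [Ne, Ideal.span_singleton_eq_top]
    simpa using ham
  have : Nontrivial (A ⧸ Ideal.span {a}) := Ideal.Quotient.nontrivial_iff.mpr hne
  have : IsLocalRing (A ⧸ Ideal.span {a}) :=
    IsLocalRing.of_surjective' (Ideal.Quotient.mk _) Ideal.Quotient.mk_surjective
  have hnil : IsNilpotent (Ideal.Quotient.mk (Ideal.span {a}) x) := by
    rw [Ring.KrullDimLE.isNilpotent_iff_mem_nonunits, mem_nonunits_iff]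
    intro hu
    have := IsLocalHom.of_surjective (Ideal.Quotient.mk (Ideal.span {a}))
      Ideal.Quotient.mk_surjective
    have := (isUnit_map_iff (Ideal.Quotient.mk (Ideal.span {a})) x).mp hu
    exact (by simpa using hx : ¬ IsUnit x) this
  obtain ⟨n, hn⟩ := hnil
  exact ⟨n, by rwa [← map_pow, Ideal.Quotient.eq_zero_iff_mem] at hn⟩

theorem exists_isParameter : ∃ a : A, IsParameter a := by
  obtain ⟨rs, hrs, hl⟩ := IsOneDimCMLocalRing.exists_isRegular (R := A)
  obtain ⟨r, rfl⟩ := length_eq_one_of_cast_eq_ringKrullDim hl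
  obtain ⟨hr, hr'⟩ := hrs.mem_maximalIdeal_and_isSMulRegular
  refine ⟨r, isParameter_of_mem_nonZeroDivisors ?_ hr⟩
  rw [mem_nonZeroDivisors_iff_right]
  intro x hx
  exact hr' (by simpa [mul_comm] using hx)

end OneDimensional

/-! ### Colengths of ideals. -/

section Colength

variable {A : Type u} [CommRing A]

/-- The colength of an ideal. -/
noncomputable abbrev Ideal.colength (P : Ideal A) : ℕ∞ := Module.length A (A ⧸ P)

theorem Ideal.isFiniteLength_quotient [IsNoetherianRing A] [Ring.KrullDimLE 1 A] {P : Ideal A}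
    {b : A} (hb : b ∈ nonZeroDivisors A) (hbP : b ∈ P) : IsFiniteLength A (A ⧸ P) :=
  (isFiniteLength_quotient_span_singleton A hb).of_surjective
    (Submodule.factor_surjective ((Ideal.span_singleton_le_iff_mem P).mpr hbP))

theorem Ideal.colength_ne_top [IsNoetherianRing A] [Ring.KrullDimLE 1 A] {P : Ideal A}
    {b : A} (hb : b ∈ nonZeroDivisors A) (hbP : b ∈ P) : P.colength ≠ ⊤ :=
  Module.length_ne_top_iff.mpr (Ideal.isFiniteLength_quotient hb hbP)

open Pointwise in
theorem Ideal.colength_span_singleton_mul {b : A} (hb : b ∈ nonZeroDivisors A) (P : Ideal A) :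
    (Ideal.span {b} * P).colength = (Ideal.span {b}).colength + P.colength := by
  rw [← smul_eq_mul, Submodule.ideal_span_singleton_smul, add_comm]
  exact Module.length_eq_add_of_exact _ _ (Ideal.mulQuot_injective P hb)
    (Ideal.quotOfMul_surjective P) (Ideal.exact_mulQuot_quotOfMul P)

theorem Ideal.colength_span_singleton_pow {b : A} (hb : b ∈ nonZeroDivisors A) (n : ℕ) :
    (Ideal.span {b ^ n}).colength = n * (Ideal.span {b}).colength := by
  induction n with
  | zero =>
    simp only [pow_zero, Ideal.span_singleton_one, Nat.cast_zero, zero_mul]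
    exact Module.length_eq_zero
  | succ n ih =>
    rw [pow_succ', ← Ideal.span_singleton_mul_span_singleton, Ideal.colength_span_singleton_mul hb,
      ih]
    push_cast
    ring

theorem Ideal.length_subquotient_add_colength {P Q : Ideal A} (h : Q ≤ P) :
    Q.colength = Module.length A (P ⧸ Q.submoduleOf P) + P.colength := by
  let f : (P ⧸ Q.submoduleOf P) →ₗ[A] A ⧸ Q :=
    (Q.submoduleOf P).liftQ (Q.mkQ ∘ₗ P.subtype) fun x hx => by
      exact (Submodule.Quotient.mk_eq_zero Q).mpr (show (x : A) ∈ Q from hx)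
  have hf : ∀ x : P, f (Submodule.Quotient.mk x) = Submodule.Quotient.mk (x : A) := fun x => rfl
  refine Module.length_eq_add_of_exact f (Submodule.factor h) ?_ (Submodule.factor_surjective h) ?_
  · rw [injective_iff_map_eq_zero]
    intro x hx
    obtain ⟨x, rfl⟩ := Submodule.Quotient.mk_surjective _ x
    rw [hf, Submodule.Quotient.mk_eq_zero] at hx
    exact (Submodule.Quotient.mk_eq_zero _).mpr hx
  · intro x
    obtain ⟨x, rfl⟩ := Submodule.Quotient.mk_surjective _ x
    have hfac : Submodule.factor h (Submodule.Quotient.mk x) = Submodule.Quotient.mk x := rfl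
    rw [hfac, Submodule.Quotient.mk_eq_zero]
    constructor
    · exact fun hx => ⟨Submodule.Quotient.mk ⟨x, hx⟩, hf _⟩
    · rintro ⟨y, hy⟩
      obtain ⟨y, rfl⟩ := Submodule.Quotient.mk_surjective _ y
      rw [hf, Submodule.Quotient.eq] at hy
      simpa using P.sub_mem y.2 (h hy)

theorem Ideal.eq_of_le_of_colength_le {P Q : Ideal A} (h : Q ≤ P) (hP : Q.colength ≠ ⊤)
    (hle : Q.colength ≤ P.colength) : Q = P := by
  have := Ideal.length_subquotient_add_colength h
  have hPt : P.colength ≠ ⊤ := fun h => hP (by rw [this, h, add_top])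
  have h0 : Module.length A (P ⧸ Q.submoduleOf P) = 0 := by
    by_contra h0
    have : P.colength < Q.colength := by
      rw [this]
      exact ENat.lt_add_left hPt (pos_iff_ne_zero.mpr h0)
    exact absurd hle (not_le.mpr this)
  rw [Module.length_eq_zero_iff, Submodule.Quotient.subsingleton_iff] at h0
  exact le_antisymm h (Submodule.submoduleOf_eq_top.mp h0)

end Colength

theorem Module.length_eq_length_quotient_add {A : Type*} [CommRing A] {N : Type*}
    [AddCommGroup N] [Module A N] (N' : Submodule A N) :
    Module.length A N = Module.length A (N ⧸ N') + Module.length A N' := by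
  rw [add_comm]
  exact Module.length_eq_add_of_exact _ _ N'.subtype_injective N'.mkQ_surjective
    (LinearMap.exact_subtype_mkQ N')

theorem LinearMap.length_eq_length_ker_lcomp_add {A : Type*} [CommRing A] {M N : Type*}
    [AddCommGroup M] [Module A M] [AddCommGroup N] [Module A N] (N' : Submodule A N) :
    Module.length A (N →ₗ[A] M) = Module.length A ((N ⧸ N') →ₗ[A] M) +
      Module.length A (LinearMap.range (LinearMap.lcomp A M N'.subtype)) := by
  refine Module.length_eq_add_of_exact (LinearMap.lcomp A M N'.mkQ)
    (LinearMap.lcomp A M N'.subtype).rangeRestrict ?_ (LinearMap.surjective_rangeRestrict _) ?_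
  · exact LinearMap.lcomp_injective_of_surjective _ N'.mkQ_surjective
  · intro f
    constructor
    · intro hf
      have hf' : f ∘ₗ N'.subtype = 0 := congrArg Subtype.val hf
      refine ⟨N'.liftQ f fun x hx => ?_, by ext; rfl⟩
      exact LinearMap.congr_fun hf' ⟨x, hx⟩
    · rintro ⟨g, rfl⟩
      apply Subtype.ext
      ext x
      change g (Submodule.Quotient.mk (x : N)) = 0
      rw [(Submodule.Quotient.mk_eq_zero N').mpr x.2, map_zero]

/-! ### Simple socles and lengths of Hom modules. -/

section Socle

variable {A : Type u} [CommRing A] [IsLocalRing A]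

/-- The socle of `M` is simple: it is spanned by a nonzero element. -/
def HasSimpleSocle (A : Type*) [CommRing A] [IsLocalRing A] (M : Type*) [AddCommGroup M]
    [Module A M] : Prop :=
  ∃ s : M, s ≠ 0 ∧ (∀ x ∈ maximalIdeal A, x • s = 0) ∧
    ∀ t : M, (∀ x ∈ maximalIdeal A, x • t = 0) → ∃ r : A, t = r • s

theorem HasSimpleSocle.congr {M N : Type*} [AddCommGroup M] [Module A M] [AddCommGroup N]
    [Module A N] (e : M ≃ₗ[A] N) (h : HasSimpleSocle A M) : HasSimpleSocle A N := by
  obtain ⟨s, hs, hm, ht⟩ := h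
  refine ⟨e s, by simpa using hs, fun x hx => by rw [← map_smul, hm x hx, map_zero],
    fun t h => ?_⟩
  obtain ⟨r, hr⟩ := ht (e.symm t) fun x hx => by rw [← map_smul, h x hx, map_zero]
  exact ⟨r, by rw [← map_smul, ← hr, e.apply_symm_apply]⟩

/-- Evaluation at the class of `1` identifies `Hom(A/m, M)` with the socle of `M`. -/
theorem length_hom_quotient_maximalIdeal {M : Type*} [AddCommGroup M] [Module A M] :
    Module.length A ((A ⧸ maximalIdeal A) →ₗ[A] M) = 1 ↔ HasSimpleSocle A M := by
  have hkill : ∀ (f : (A ⧸ maximalIdeal A) →ₗ[A] M), ∀ x ∈ maximalIdeal A,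
      x • f (Submodule.Quotient.mk 1) = 0 := fun f x hx => by
    rw [← map_smul, ← Submodule.Quotient.mk_smul, smul_eq_mul, mul_one,
      (Submodule.Quotient.mk_eq_zero _).mpr hx, map_zero]
  have hext : ∀ (f g : (A ⧸ maximalIdeal A) →ₗ[A] M),
      f (Submodule.Quotient.mk 1) = g (Submodule.Quotient.mk 1) → f = g := fun f g h => by
    apply Submodule.linearMap_qext
    ext
    simpa using h
  have hex : ∀ s : M, (∀ x ∈ maximalIdeal A, x • s = 0) →
      ∃ f : (A ⧸ maximalIdeal A) →ₗ[A] M, f (Submodule.Quotient.mk 1) = s := fun s hs =>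
    ⟨(maximalIdeal A).liftQ (LinearMap.toSpanSingleton A M s)
      fun x hx => by simpa using hs x hx, one_smul A s⟩
  rw [Module.length_eq_one_iff]
  constructor
  · intro h
    have := IsSimpleModule.nontrivial A ((A ⧸ maximalIdeal A) →ₗ[A] M)
    obtain ⟨f, hf⟩ := exists_ne (0 : (A ⧸ maximalIdeal A) →ₗ[A] M)
    refine ⟨f (Submodule.Quotient.mk 1), fun h0 => hf (hext f 0 (by simpa using h0)), hkill f,
      fun t ht => ?_⟩
    obtain ⟨g, rfl⟩ := hex t ht
    obtain ⟨r, rfl⟩ := IsSimpleModule.toSpanSingleton_surjective A hf g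
    exact ⟨r, rfl⟩
  · rintro ⟨s, hs, hm, ht⟩
    obtain ⟨f, rfl⟩ := hex s hm
    have hf : f ≠ 0 := by
      rintro rfl
      exact hs rfl
    refine isSimpleModule_iff_toSpanSingleton_surjective.mpr ⟨⟨f, 0, hf⟩, fun g hg h => ?_⟩
    obtain ⟨r, hr⟩ := ht _ (hkill g)
    have hr' : g = r • f := hext _ _ (by simpa using hr)
    have hu : IsUnit r := by
      by_contra hu
      refine hg (hext g 0 ?_)
      rw [hr]
      exact hkill f r ((mem_maximalIdeal r).mpr hu)
    obtain ⟨q, hq⟩ := ht _ (hkill h)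
    obtain ⟨v, hv⟩ := hu.exists_left_inv
    refine ⟨q * v, hext _ _ ?_⟩
    rw [LinearMap.toSpanSingleton_apply, hr', hq, LinearMap.smul_apply, LinearMap.smul_apply,
      smul_smul, mul_assoc, hv, mul_one]

variable {M : Type*} [AddCommGroup M] [Module A M]

/-- Dévissage: by left exactness of Hom, each composition factor `A / m` of `N` contributes at most
`ℓ(Hom(A / m, M)) = 1`. -/
theorem HasSimpleSocle.length_hom_le (hM : HasSimpleSocle A M) {N : Type*} [AddCommGroup N]
    [Module A N] (hN : IsFiniteLength A N) :
    Module.length A (N →ₗ[A] M) ≤ Module.length A N := by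
  induction hN with
  | of_subsingleton => simp [Module.length_eq_zero]
  | @of_simple_quotient N _ _ N' hs _ ih =>
    rw [LinearMap.length_eq_length_ker_lcomp_add N', Module.length_eq_length_quotient_add N']
    gcongr
    · obtain ⟨m, hm, ⟨e⟩⟩ := isSimpleModule_iff_quot_maximal.mp hs
      obtain rfl := eq_maximalIdeal hm
      rw [(LinearEquiv.congrLeft M A e).length_eq, length_hom_quotient_maximalIdeal.mpr hM,
        Module.length_eq_one]
    · exact (Module.length_le_of_injective _ (Submodule.subtype_injective _)).trans ih

/-- Over a local ring, a module with simple socle has the extension property for submodules of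
a finite length module `N`, as soon as `Hom(N, M)` is as long as `N`. -/
theorem HasSimpleSocle.exists_extension (hM : HasSimpleSocle A M) {N : Type*} [AddCommGroup N]
    [Module A N] (hN : IsFiniteLength A N)
    (hle : Module.length A N ≤ Module.length A (N →ₗ[A] M)) (N' : Submodule A N)
    (f : N' →ₗ[A] M) : ∃ g : N →ₗ[A] M, ∀ x : N', g x = f x := by
  have hN' : IsFiniteLength A N' := hN.of_injective N'.subtype_injective
  have hQ : IsFiniteLength A (N ⧸ N') := hN.of_surjective N'.mkQ_surjective
  have h1 := hM.length_hom_le hN'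
  have h2 := hM.length_hom_le hQ
  rw [LinearMap.length_eq_length_ker_lcomp_add N',
    Module.length_eq_length_quotient_add N'] at hle
  -- The finite summand `ℓ(N / N')` bounds `ℓ(Hom(N / N', M))` and cancels. What remains makes the
  -- image of restriction as long as `Hom(N', M)` can be, so restriction is onto.
  have h3 : Module.length A N' ≤
      Module.length A (LinearMap.range (LinearMap.lcomp A M N'.subtype)) :=
    (ENat.add_le_add_iff_left (Module.length_ne_top_iff.mpr hQ)).mp (hle.trans (by gcongr))
  have hfin : IsFiniteLength A (N' →ₗ[A] M) := Module.length_ne_top_iff.mp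
    (ne_top_of_le_ne_top (Module.length_ne_top_iff.mpr hN') h1)
  obtain ⟨_, _⟩ := isFiniteLength_iff_isNoetherian_isArtinian.mp hfin
  have htop : LinearMap.range (LinearMap.lcomp A M N'.subtype) = ⊤ := by
    by_contra hne
    exact absurd (Submodule.length_lt hne) (not_lt.mpr (h1.trans h3))
  obtain ⟨g, hg⟩ := LinearMap.range_eq_top.mp htop f
  exact ⟨g, fun x => LinearMap.congr_fun hg x⟩

end Socle

/-! ### The quotient `J / cJ` as a dualizing module over `A / c`. -/

section TypeOne

open Pointwise

variable {A : Type u} [CommRing A]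

theorem Ideal.smul_top_eq_submoduleOf (J : Ideal A) (c : A) :
    (c • ⊤ : Submodule A J) = (Ideal.span {c} * J).submoduleOf J := by
  ext x
  rw [Submodule.mem_smul_pointwise_iff_exists, Submodule.submoduleOf, Submodule.mem_comap,
    Submodule.subtype_apply, Ideal.mem_span_singleton_mul]
  constructor
  · rintro ⟨y, -, rfl⟩
    exact ⟨y, y.2, rfl⟩
  · rintro ⟨z, hz, h⟩
    exact ⟨⟨z, hz⟩, trivial, Subtype.ext h⟩

theorem Ideal.mk_smul_top_eq_zero_iff {J : Ideal A} {c : A} {x : J} :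
    (Submodule.Quotient.mk x : J ⧸ (c • ⊤ : Submodule A J)) = 0 ↔
      ∃ z ∈ J, c * z = x := by
  rw [Submodule.Quotient.mk_eq_zero, Ideal.smul_top_eq_submoduleOf, Submodule.submoduleOf,
    Submodule.mem_comap, Submodule.subtype_apply, Ideal.mem_span_singleton_mul]

theorem Ideal.length_quotient_smul_top [IsNoetherianRing A] [Ring.KrullDimLE 1 A] {J : Ideal A}
    {c d : A} (hc : c ∈ nonZeroDivisors A) (hd : d ∈ nonZeroDivisors A) (hdJ : d ∈ J) :
    Module.length A (J ⧸ (c • ⊤ : Submodule A J)) = (Ideal.span {c}).colength := by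
  have h1 := Ideal.length_subquotient_add_colength (Ideal.mul_le_right : Ideal.span {c} * J ≤ J)
  rw [Ideal.colength_span_singleton_mul hc, ← Ideal.smul_top_eq_submoduleOf] at h1
  exact (ENat.add_left_injective_of_ne_top (Ideal.colength_ne_top hd hdJ) h1).symm

theorem Module.length_le_length_hom_quotient {M : Type*} [AddCommGroup M] [Module A M]
    {P : Ideal A} (h : ∀ x ∈ P, ∀ m : M, x • m = 0) :
    Module.length A M ≤ Module.length A ((A ⧸ P) →ₗ[A] M) := by
  refine Module.length_le_of_surjective
    (LinearMap.applyₗ (Submodule.Quotient.mk 1 : A ⧸ P)) fun m =>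
      ⟨P.liftQ (LinearMap.toSpanSingleton A M m) fun x hx => by simpa using h x hx m, one_smul A m⟩

theorem LinearMap.exists_eq_comp_of_surjective {R M N P : Type*} [Ring R] [AddCommGroup M]
    [Module R M] [AddCommGroup N] [Module R N] [AddCommGroup P] [Module R P]
    (p : M →ₗ[R] N) (hp : Function.Surjective p) (f : M →ₗ[R] P)
    (h : ∀ x, p x = 0 → f x = 0) : ∃ g : N →ₗ[R] P, ∀ x, g (p x) = f x := by
  refine ⟨(LinearMap.ker p).liftQ f (fun x hx => h x hx) ∘ₗ
    (p.quotKerEquivOfSurjective hp).symm.toLinearMap, fun x => ?_⟩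
  have : (p.quotKerEquivOfSurjective hp).symm (p x) = Submodule.Quotient.mk x := by
    rw [LinearEquiv.symm_apply_eq]
    rfl
  rw [LinearMap.comp_apply, LinearEquiv.coe_coe, this]
  rfl

theorem Ideal.smul_quotient_smul_top_eq_zero {J : Ideal A} {c x : A} (hx : x ∈ Ideal.span {c})
    (m : J ⧸ (c • ⊤ : Submodule A J)) : x • m = 0 := by
  obtain ⟨m, rfl⟩ := Submodule.Quotient.mk_surjective _ m
  obtain ⟨r, rfl⟩ := Ideal.mem_span_singleton'.mp hx
  rw [← Submodule.Quotient.mk_smul, Ideal.mk_smul_top_eq_zero_iff]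
  exact ⟨r * m, J.mul_mem_left _ m.2, by simp only [SetLike.val_smul, smul_eq_mul]; ring⟩

variable [IsLocalRing A] [IsNoetherianRing A] [Ring.KrullDimLE 1 A]

/-- A linear map from an ideal `P` to `J / cJ` which vanishes on `P ∩ (c)` is given by
multiplication with an element of `J`, if `J / cJ` has simple socle. -/
theorem HasSimpleSocle.exists_eq_smul {J : Ideal A} {c d : A} (hc : c ∈ nonZeroDivisors A)
    (hd : d ∈ nonZeroDivisors A) (hdJ : d ∈ J)
    (hJ : HasSimpleSocle A (J ⧸ (c • ⊤ : Submodule A J))) (P : Ideal A)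
    (f : P →ₗ[A] J ⧸ (c • ⊤ : Submodule A J))
    (hf : ∀ x : P, (x : A) ∈ Ideal.span {c} → f x = 0) :
    ∃ y : J, ∀ x : P, f x = Submodule.Quotient.mk ((x : A) • y) := by
  let N' : Submodule A (A ⧸ Ideal.span {c}) := Submodule.map (Ideal.span {c}).mkQ P
  let p : P →ₗ[A] N' := (Ideal.span {c}).mkQ.submoduleMap P
  obtain ⟨f', hf'⟩ := LinearMap.exists_eq_comp_of_surjective p
    (LinearMap.submoduleMap_surjective _ _) f fun x hx => by
      refine hf x ?_
      have h0 : (p x : A ⧸ Ideal.span {c}) = 0 := by rw [hx]; rfl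
      exact (Submodule.Quotient.mk_eq_zero _).mp h0
  -- Evaluation at `1` maps `Hom(A / c, J / cJ)` onto `J / cJ`, whose length is that of `A / c`;
  -- this is the required length bound.
  obtain ⟨g, hg⟩ := hJ.exists_extension (isFiniteLength_quotient_span_singleton A hc) (by
    change (Ideal.span {c}).colength ≤ _
    rw [← Ideal.length_quotient_smul_top hc hd hdJ]
    exact Module.length_le_length_hom_quotient
      fun x hx m => Ideal.smul_quotient_smul_top_eq_zero hx m) N' f'
  obtain ⟨y, hy⟩ := Submodule.Quotient.mk_surjective _ (g (Submodule.Quotient.mk 1))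
  refine ⟨y, fun x => ?_⟩
  rw [← hf', ← hg, Submodule.Quotient.mk_smul, hy, ← map_smul, ← Submodule.Quotient.mk_smul,
    smul_eq_mul, mul_one]
  rfl

/-- Faithfulness of `J / cJ` over `A / c`. If `(c, y)` kills `J / cJ`, then `ℓ(A / c) = ℓ(J / cJ) ≤
ℓ(Hom(A / (c, y), J / cJ)) ≤ ℓ(A / (c, y))`, which forces `(c, y) = (c)`. -/
theorem HasSimpleSocle.mem_span_singleton_of_forall_mul_mem {J : Ideal A} {c d : A}
    (hc : c ∈ nonZeroDivisors A) (hd : d ∈ nonZeroDivisors A) (hdJ : d ∈ J)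
    (hJ : HasSimpleSocle A (J ⧸ (c • ⊤ : Submodule A J))) {y : A}
    (hy : ∀ z ∈ J, y * z ∈ Ideal.span {c} * J) : y ∈ Ideal.span {c} := by
  have hle : Ideal.span {c} ≤ Ideal.span {c} ⊔ Ideal.span {y} := le_sup_left
  rw [Ideal.eq_of_le_of_colength_le hle
    (Ideal.colength_ne_top hc (Ideal.mem_span_singleton_self c)) ?_]
  · exact (le_sup_right : Ideal.span {y} ≤ _) (Ideal.mem_span_singleton_self y)
  · rw [← Ideal.length_quotient_smul_top hc hd hdJ]
    refine (Module.length_le_length_hom_quotient (P := Ideal.span {c} ⊔ Ideal.span {y})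
      fun x hx m => ?_).trans (hJ.length_hom_le (Ideal.isFiniteLength_quotient hc
        (hle (Ideal.mem_span_singleton_self c))))
    obtain ⟨u, hu, v, hv, rfl⟩ := Submodule.mem_sup.mp hx
    rw [add_smul, Ideal.smul_quotient_smul_top_eq_zero hu, zero_add]
    obtain ⟨m, rfl⟩ := Submodule.Quotient.mk_surjective _ m
    obtain ⟨r, rfl⟩ := Ideal.mem_span_singleton'.mp hv
    rw [mul_smul, ← Submodule.Quotient.mk_smul, (Ideal.mk_smul_top_eq_zero_iff).mpr, smul_zero]
    exact Ideal.mem_span_singleton_mul.mp (hy m m.2)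

end TypeOne

/-! ### Ideals of type one are unique up to fractional multiples. -/

section Uniqueness

open Pointwise

variable {A : Type u} [CommRing A]

/-- An ideal `J` has type one if `J / cJ` has simple socle for every nonzerodivisor `c` in the
maximal ideal. -/
def Ideal.IsTypeOne [IsLocalRing A] (J : Ideal A) : Prop :=
  ∀ c ∈ nonZeroDivisors A, c ∈ maximalIdeal A → HasSimpleSocle A (J ⧸ (c • ⊤ : Submodule A J))

/-- The socle is essential: a nonzero `Ax` of finite length contains a simple submodule, which `m`
kills and which is therefore spanned by a unit multiple of `s`. -/
theorem HasSimpleSocle.exists_smul_eq [IsLocalRing A] {M : Type*} [AddCommGroup M] [Module A M]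
    (hfin : IsFiniteLength A M) {s : M} (hm : ∀ x ∈ maximalIdeal A, x • s = 0)
    (hs : ∀ t : M, (∀ x ∈ maximalIdeal A, x • t = 0) → ∃ r : A, t = r • s) {x : M} (hx : x ≠ 0) :
    ∃ r : A, r • x = s := by
  obtain ⟨_, _⟩ := isFiniteLength_iff_isNoetherian_isArtinian.mp hfin
  obtain ⟨S, hS, hle⟩ := (eq_bot_or_exists_atom_le (Submodule.span A {x})).resolve_left
    (by simpa using hx)
  have hsimple : IsSimpleModule A S := isSimpleModule_iff_isAtom.mpr hS
  obtain ⟨t, htS, ht⟩ := S.ne_bot_iff.mp hS.1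
  have hmt : ∀ y ∈ maximalIdeal A, y • t = 0 := by
    intro y hy
    by_contra hne
    have hne' : y • (⟨t, htS⟩ : S) ≠ 0 := fun h => hne (congrArg Subtype.val h)
    obtain ⟨r, hr⟩ := IsSimpleModule.toSpanSingleton_surjective A hne' ⟨t, htS⟩
    have hr' : (1 - r * y) • t = 0 := by
      have := congrArg Subtype.val hr
      simp only [LinearMap.toSpanSingleton_apply, SetLike.val_smul, smul_smul] at this
      rw [sub_smul, one_smul, this, sub_self]
    have hu : IsUnit (1 - r * y) := by
      by_contra hu
      have := Ideal.add_mem _ ((mem_maximalIdeal _).mpr hu) (Ideal.mul_mem_left _ r hy)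
      rw [sub_add_cancel] at this
      exact (Ideal.ne_top_iff_one _).mp (maximalIdeal.isMaximal A).ne_top this
    exact ht (hu.smul_eq_zero.mp hr')
  obtain ⟨r, rfl⟩ := hs t hmt
  have hu : IsUnit r := by
    by_contra hu
    exact ht (hm r ((mem_maximalIdeal r).mpr hu))
  obtain ⟨q, hq⟩ := Submodule.mem_span_singleton.mp (hle htS)
  obtain ⟨v, hv⟩ := hu.exists_left_inv
  exact ⟨v * q, by rw [mul_smul, hq, smul_smul, hv, one_smul]⟩

theorem LinearMap.surjective_of_injective_of_length_eq {A : Type*} [CommRing A] {M N : Type*}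
    [AddCommGroup M] [Module A M] [AddCommGroup N] [Module A N] (hN : IsFiniteLength A N)
    (h : Module.length A M = Module.length A N) (f : M →ₗ[A] N) (hf : Function.Injective f) :
    Function.Surjective f := by
  obtain ⟨_, _⟩ := isFiniteLength_iff_isNoetherian_isArtinian.mp hN
  rw [← LinearMap.range_eq_top]
  by_contra hne
  have := Submodule.length_lt hne
  rw [← (LinearEquiv.ofInjective f hf).length_eq, h] at this
  exact lt_irrefl _ this

/-- If every element `x * y` with `x ∈ J` is a multiple `d * z` with `z ∈ J'`, there is a linear
map `J → J'`, namely multiplication by `y / d`. -/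
theorem Ideal.exists_linearMap_mul_eq {J J' : Ideal A} {d y : A} (hd : d ∈ nonZeroDivisors A)
    (h : ∀ x ∈ J, ∃ z ∈ J', d * z = x * y) :
    ∃ g : J →ₗ[A] J', ∀ x : J, d * (g x : A) = x * y := by
  choose g hg hg' using h
  refine ⟨{ toFun := fun x => ⟨g x x.2, hg x x.2⟩, map_add' := fun u v => Subtype.ext ?_,
            map_smul' := fun r u => Subtype.ext ?_ }, fun x => hg' x x.2⟩
  · refine (mul_cancel_left_mem_nonZeroDivisors hd).mp ?_
    simp only [Submodule.coe_add, mul_add, hg', add_mul]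
  · refine (mul_cancel_left_mem_nonZeroDivisors hd).mp ?_
    simp only [RingHom.id_apply, SetLike.val_smul, smul_eq_mul, mul_left_comm d, hg', mul_assoc]

variable [IsOneDimCMLocalRing A]

/-- The multiplier `y / d : J → J'` is found by prescribing it on socles: it must send a socle
generator `s` of `J / bJ` to one of `J' / bJ'`. Such a map is injective modulo `b`, hence bijective
by equality of lengths, hence onto by Nakayama. -/
theorem Ideal.IsTypeOne.exists_mul_eq_mul {J J' : Ideal A} (hJ : J.IsTypeOne) (hJ' : J'.IsTypeOne)
    {d d' : A} (hd : d ∈ nonZeroDivisors A) (hdJ : d ∈ J) (hd' : d' ∈ nonZeroDivisors A)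
    (hdJ' : d' ∈ J') : ∃ y ∈ nonZeroDivisors A, Ideal.span {y} * J = Ideal.span {d} * J' := by
  obtain ⟨b, hbp⟩ := exists_isParameter (A := A)
  have hb := hbp.mem_nonZeroDivisors
  have hbm := hbp.mem_maximalIdeal
  have hfin : ∀ {L : Ideal A} {e : A}, e ∈ nonZeroDivisors A → e ∈ L →
      IsFiniteLength A (L ⧸ (b • ⊤ : Submodule A L)) := fun he heL => by
    rw [← Module.length_ne_top_iff, Ideal.length_quotient_smul_top hb he heL]
    exact Ideal.colength_ne_top hb (Ideal.mem_span_singleton_self b)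
  obtain ⟨s, hs0, hsm, hs⟩ := hJ b hb hbm
  obtain ⟨s', hs0', hsm', hs'⟩ := hJ' b hb hbm
  obtain ⟨s, rfl⟩ := Submodule.Quotient.mk_surjective _ s
  obtain ⟨s', rfl⟩ := Submodule.Quotient.mk_surjective _ s'
  have hbd : b * d ∈ nonZeroDivisors A := mul_mem hb hd
  -- the map `s ↦ d s'`, `bJ ↦ 0`
  let P : Ideal A := Ideal.span {(s : A)} ⊔ Ideal.span {b} * J
  let p₀ : A × ↥(Ideal.span {b} * J) →ₗ[A] A :=
    (LinearMap.toSpanSingleton A A (s : A)).coprod (Ideal.span {b} * J).subtype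
  have hp₀ : ∀ x, p₀ x = x.1 * s + x.2 := fun x => by simp [p₀]
  let p : A × ↥(Ideal.span {b} * J) →ₗ[A] P := p₀.codRestrict P fun x => by
    rw [hp₀]
    exact add_mem (Ideal.mem_sup_left (Ideal.mul_mem_left _ _ (Ideal.mem_span_singleton_self _)))
      (Ideal.mem_sup_right x.2.2)
  have hp : Function.Surjective p := by
    rintro ⟨x, hx⟩
    obtain ⟨u, hu, v, hv, rfl⟩ := Submodule.mem_sup.mp hx
    obtain ⟨r, rfl⟩ := Ideal.mem_span_singleton'.mp hu
    exact ⟨(r, ⟨v, hv⟩), Subtype.ext (hp₀ _)⟩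
  -- The modulus is `b * d` because `d ∈ J` gives `(bd) ⊆ bJ`, where the map vanishes, as
  -- `HasSimpleSocle.exists_eq_smul` requires. The factor `d` in the value is divided out later.
  let f₀ : A × ↥(Ideal.span {b} * J) →ₗ[A] J' ⧸ ((b * d) • ⊤ : Submodule A J') :=
    LinearMap.toSpanSingleton A _ (Submodule.Quotient.mk (d • s')) ∘ₗ LinearMap.fst A _ _
  have hf₀ : ∀ x, f₀ x = Submodule.Quotient.mk (x.1 • d • s') := fun x => rfl
  have hvan : ∀ x, (p x : A) ∈ Ideal.span {b} * J → f₀ x = 0 := by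
    intro x hx
    have hx' : x.1 * s ∈ Ideal.span {b} * J := by
      have h1 : (p x : A) = x.1 * s + x.2 := hp₀ x
      rw [h1] at hx
      exact (Submodule.add_mem_iff_left _ x.2.2).mp hx
    have hxm : x.1 ∈ maximalIdeal A := by
      rw [mem_maximalIdeal]
      intro hu
      refine hs0 (hu.smul_eq_zero.mp ?_)
      rw [← Submodule.Quotient.mk_smul, Ideal.mk_smul_top_eq_zero_iff]
      exact Ideal.mem_span_singleton_mul.mp hx'
    have h2 := hsm' x.1 hxm
    rw [← Submodule.Quotient.mk_smul, Ideal.mk_smul_top_eq_zero_iff] at h2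
    obtain ⟨z, hz, h2⟩ := h2
    rw [hf₀, Ideal.mk_smul_top_eq_zero_iff]
    refine ⟨z, hz, ?_⟩
    simp only [SetLike.val_smul, smul_eq_mul] at h2 ⊢
    linear_combination d * h2
  obtain ⟨f, hf⟩ := LinearMap.exists_eq_comp_of_surjective p hp f₀ fun x hx =>
    hvan x (by rw [hx]; exact zero_mem _)
  have hbdm : b * d ∈ maximalIdeal A := Ideal.mul_mem_right _ _ hbm
  obtain ⟨y, hy⟩ := (hJ' (b * d) hbd hbdm).exists_eq_smul hbd hd' hdJ' P f fun x hx => by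
    obtain ⟨x, rfl⟩ := hp x
    rw [hf]
    refine hvan x ?_
    obtain ⟨r, hr⟩ := Ideal.mem_span_singleton'.mp hx
    rw [← hr, Ideal.mem_span_singleton_mul]
    exact ⟨r * d, J.mul_mem_left _ hdJ, by ring⟩
  -- multiplication by `y / d` maps `J` to `J'`
  have hyd : ∀ x ∈ J, ∃ z ∈ J', d * z = x * y := by
    intro x hx
    have hbx : b * x ∈ Ideal.span {b} * J := Ideal.mul_mem_mul (Ideal.mem_span_singleton_self b) hx
    have h1 := hy (p (0, ⟨b * x, hbx⟩))
    have h2 : (p (0, ⟨b * x, hbx⟩) : A) = b * x := by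
      change p₀ _ = _
      rw [hp₀]
      simp
    rw [hf, hf₀, zero_smul, h2] at h1
    obtain ⟨z, hz, h3⟩ := Ideal.mk_smul_top_eq_zero_iff.mp h1.symm
    refine ⟨z, hz, (mul_cancel_left_mem_nonZeroDivisors hb).mp ?_⟩
    simp only [SetLike.val_smul, smul_eq_mul] at h3
    linear_combination h3
  obtain ⟨g, hg⟩ := Ideal.exists_linearMap_mul_eq hd hyd
  have hgs : (Submodule.Quotient.mk (g s) : J' ⧸ (b • ⊤ : Submodule A J')) =
      Submodule.Quotient.mk s' := by
    have h1 := hy (p (1, 0))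
    have h2 : (p (1, 0) : A) = s := by
      change p₀ _ = _
      rw [hp₀]
      simp
    rw [hf, hf₀, one_smul, h2, eq_comm, ← sub_eq_zero, ← Submodule.Quotient.mk_sub] at h1
    obtain ⟨z, hz, h3⟩ := Ideal.mk_smul_top_eq_zero_iff.mp h1
    rw [← sub_eq_zero, ← Submodule.Quotient.mk_sub, Ideal.mk_smul_top_eq_zero_iff]
    refine ⟨z, hz, (mul_cancel_left_mem_nonZeroDivisors hd).mp ?_⟩
    simp only [SetLike.val_smul, smul_eq_mul, Submodule.coe_sub] at h3 ⊢
    linear_combination h3 - hg s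
  have hgle : (b • ⊤ : Submodule A J) ≤ (b • ⊤ : Submodule A J').comap g := by
    intro x hx
    obtain ⟨x', -, rfl⟩ := (Submodule.mem_smul_pointwise_iff_exists _ _ _).mp hx
    rw [Submodule.mem_comap, map_smul]
    exact Submodule.smul_mem_pointwise_smul _ _ _ trivial
  let gb : (J ⧸ (b • ⊤ : Submodule A J)) →ₗ[A] J' ⧸ (b • ⊤ : Submodule A J') :=
    Submodule.mapQ _ _ g hgle
  have hgb : ∀ x, gb (Submodule.Quotient.mk x) = Submodule.Quotient.mk (g x) := fun x => rfl
  have hinj : Function.Injective gb := by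
    rw [injective_iff_map_eq_zero]
    intro x hx
    by_contra hne
    obtain ⟨r, hr⟩ := HasSimpleSocle.exists_smul_eq (hfin hd hdJ) hsm hs hne
    refine hs0' ?_
    rw [← hgs, ← hgb, ← hr, map_smul, hx, smul_zero]
  have hsurj : Function.Surjective gb :=
    LinearMap.surjective_of_injective_of_length_eq (hfin hd' hdJ')
      (by rw [Ideal.length_quotient_smul_top hb hd hdJ, Ideal.length_quotient_smul_top hb hd' hdJ'])
      gb hinj
  have hgtop : LinearMap.range g = ⊤ := by
    refine top_le_iff.mp (Submodule.le_of_le_smul_of_le_jacobson_bot (I := Ideal.span {b})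
      (Module.Finite.fg_top) ?_ ?_)
    · rw [Ideal.span_singleton_le_iff_mem, IsLocalRing.jacobson_eq_maximalIdeal _ bot_ne_top]
      exact hbm
    · intro z _
      obtain ⟨x, hx⟩ := hsurj (Submodule.Quotient.mk z)
      obtain ⟨x, rfl⟩ := Submodule.Quotient.mk_surjective _ x
      rw [hgb, eq_comm, Submodule.Quotient.eq] at hx
      rw [Submodule.ideal_span_singleton_smul]
      rw [← add_sub_cancel (g x) z]
      exact Submodule.add_mem_sup ⟨x, rfl⟩ hx
  have hEq : Ideal.span {(y : A)} * J = Ideal.span {d} * J' := by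
    ext w
    rw [Ideal.mem_span_singleton_mul, Ideal.mem_span_singleton_mul]
    constructor
    · rintro ⟨x, hx, rfl⟩
      obtain ⟨z, hz, h⟩ := hyd x hx
      exact ⟨z, hz, by rw [h, mul_comm]⟩
    · rintro ⟨z, hz, rfl⟩
      obtain ⟨x, hx⟩ := LinearMap.range_eq_top.mp hgtop ⟨z, hz⟩
      exact ⟨x, x.2, by rw [mul_comm, ← hg, hx]⟩
  refine ⟨y, ?_, hEq⟩
  obtain ⟨x, -, hx⟩ := Ideal.mem_span_singleton_mul.mp
    (hEq.ge (Ideal.mul_mem_mul (Ideal.mem_span_singleton_self d) hdJ'))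
  have : (y : A) * x ∈ nonZeroDivisors A := by
    rw [hx]
    exact mul_mem hd hd'
  exact (mul_mem_nonZeroDivisors.mp this).1

end Uniqueness

/-! ### Graded pieces of the Sally module of length zero or one. -/

section Reduction

variable {A : Type u} [CommRing A]

theorem Ideal.pow_succ_eq_span_singleton_mul_of_le {I : Ideal A} {a : A} {n m : ℕ}
    (h : I ^ (n + 1) = Ideal.span {a} * I ^ n) (hnm : n ≤ m) :
    I ^ (m + 1) = Ideal.span {a} * I ^ m := by
  obtain ⟨k, rfl⟩ := Nat.exists_eq_add_of_le hnm
  rw [show n + k + 1 = (n + 1) + k by ring, pow_add, h, pow_add, mul_assoc]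

/-- The length of the graded piece `I ^ (n + 1) / a ^ n I` of the Sally module. -/
noncomputable def sallyLength (I : Ideal A) (a : A) (n : ℕ) : ℕ∞ :=
  Module.length A (↥(I ^ (n + 1)) ⧸ (Ideal.span {a ^ n} * I).submoduleOf (I ^ (n + 1)))

theorem Ideal.span_singleton_pow_mul_le {I : Ideal A} {a : A} (ha : a ∈ I) (n : ℕ) :
    Ideal.span {a ^ n} * I ≤ I ^ (n + 1) := by
  rw [pow_succ]
  exact Ideal.mul_mono_left ((Ideal.span_singleton_le_iff_mem _).mpr (Ideal.pow_mem_pow ha n))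

theorem sallyLength_add_colength {I : Ideal A} {a : A} (ha : a ∈ nonZeroDivisors A) (haI : a ∈ I)
    (n : ℕ) : sallyLength I a n + (I ^ (n + 1)).colength =
      n * (Ideal.span {a}).colength + I.colength := by
  rw [sallyLength, ← Ideal.length_subquotient_add_colength (Ideal.span_singleton_pow_mul_le haI n),
    Ideal.colength_span_singleton_mul (pow_mem ha n), Ideal.colength_span_singleton_pow ha]

theorem sallyLength_eq_zero_iff {I : Ideal A} {a : A} (haI : a ∈ I) {n : ℕ} :
    sallyLength I a n = 0 ↔ I ^ (n + 1) = Ideal.span {a ^ n} * I := by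
  rw [sallyLength, Module.length_eq_zero_iff, Submodule.Quotient.subsingleton_iff,
    Submodule.submoduleOf_eq_top]
  exact ⟨fun h => le_antisymm h (Ideal.span_singleton_pow_mul_le haI n), le_of_eq⟩

theorem Ideal.span_singleton_mul_right_inj_of_mem_nonZeroDivisors {P Q : Ideal A} {c : A}
    (hc : c ∈ nonZeroDivisors A) (h : Ideal.span {c} * P ≤ Ideal.span {c} * Q) : P ≤ Q := by
  intro x hx
  obtain ⟨z, hz, h'⟩ := Ideal.mem_span_singleton_mul.mp
    (h (Ideal.mul_mem_mul (Ideal.mem_span_singleton_self c) hx))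
  rwa [← (mul_cancel_left_mem_nonZeroDivisors hc).mp h']

theorem Ideal.eq_span_singleton_of_reduction {I : Ideal A} {a z : A} {n : ℕ}
    (ha : a ∈ nonZeroDivisors A) (haI : a ∈ I)
    (h : I ^ (n + 1) = Ideal.span {a} * I ^ n) (hz : I = Ideal.span {z}) :
    I = Ideal.span {a} := by
  have hzn : z ∈ nonZeroDivisors A := by
    rw [hz] at haI
    obtain ⟨r, rfl⟩ := Ideal.mem_span_singleton'.mp haI
    exact (mul_mem_nonZeroDivisors.mp ha).2
  rw [pow_succ, hz, Ideal.span_singleton_pow, mul_comm (Ideal.span {a})] at h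
  rw [hz]
  exact le_antisymm
    (Ideal.span_singleton_mul_right_inj_of_mem_nonZeroDivisors (pow_mem hzn n) h.le)
    (Ideal.span_singleton_mul_right_inj_of_mem_nonZeroDivisors (pow_mem hzn n) h.ge)

theorem sallyLength_eq_zero_of_eq_span_singleton {I : Ideal A} {a z : A} {n m : ℕ}
    (ha : a ∈ nonZeroDivisors A) (haI : a ∈ I)
    (h : I ^ (n + 1) = Ideal.span {a} * I ^ n) (hz : I = Ideal.span {z}) :
    sallyLength I a m = 0 := by
  rw [sallyLength_eq_zero_iff haI, pow_succ,
    Ideal.eq_span_singleton_of_reduction ha haI h hz, Ideal.span_singleton_pow]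

/-- The length of the Sally module in high degrees depends only on the isomorphism class of `I`. -/
theorem sallyLength_eq_of_span_singleton_mul_eq [IsNoetherianRing A] [Ring.KrullDimLE 1 A]
    {I I' : Ideal A} {a a' c d : A} {n : ℕ}
    (ha : a ∈ nonZeroDivisors A) (haI : a ∈ I) (ha' : a' ∈ nonZeroDivisors A) (haI' : a' ∈ I')
    (hc : c ∈ nonZeroDivisors A) (hd : d ∈ nonZeroDivisors A)
    (hI : I ^ (n + 1 + 1) = Ideal.span {a} * I ^ (n + 1))
    (hI' : I' ^ (n + 1 + 1) = Ideal.span {a'} * I' ^ (n + 1))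
    (h : Ideal.span {c} * I = Ideal.span {d} * I') :
    sallyLength I a n = sallyLength I' a' n := by
  have hpow : ∀ k, Ideal.span {c ^ k} * I ^ k = Ideal.span {d ^ k} * I' ^ k := fun k => by
    rw [← Ideal.span_singleton_pow, ← Ideal.span_singleton_pow, ← mul_pow, ← mul_pow, h]
  -- Both reductions enter here: since `ca` and `da'` have the same product with `I ^ (n + 1)`,
  -- colengths give `ℓ(A/c) + ℓ(A/a) = ℓ(A/d) + ℓ(A/a')`. The rest is arithmetic with colengths.
  have h1 : Ideal.span {c} * (Ideal.span {a} * I ^ (n + 1)) =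
      Ideal.span {d} * (Ideal.span {a'} * I ^ (n + 1)) := by
    have h2 : Ideal.span {c ^ (n + 1)} * (Ideal.span {c} * (Ideal.span {a} * I ^ (n + 1))) =
        Ideal.span {c ^ (n + 1)} * (Ideal.span {d} * (Ideal.span {a'} * I ^ (n + 1))) := by
      calc Ideal.span {c ^ (n + 1)} * (Ideal.span {c} * (Ideal.span {a} * I ^ (n + 1)))
          = Ideal.span {c ^ (n + 1 + 1)} * I ^ (n + 1 + 1) := by
            rw [← hI, ← mul_assoc, Ideal.span_singleton_mul_span_singleton, ← pow_succ]
        _ = Ideal.span {d} * (Ideal.span {a'} * (Ideal.span {d ^ (n + 1)} * I' ^ (n + 1))) := by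
            rw [hpow, hI', pow_succ', ← Ideal.span_singleton_mul_span_singleton]
            ring
        _ = _ := by
            rw [← hpow]
            ring
    exact le_antisymm
      (Ideal.span_singleton_mul_right_inj_of_mem_nonZeroDivisors (pow_mem hc _) h2.le)
      (Ideal.span_singleton_mul_right_inj_of_mem_nonZeroDivisors (pow_mem hc _) h2.ge)
  have e1 := congrArg Ideal.colength h1
  have e2 := congrArg Ideal.colength h
  have e3 := congrArg Ideal.colength (hpow (n + 1))
  have e4 := sallyLength_add_colength ha haI n
  have e5 := sallyLength_add_colength ha' haI' n
  rw [Ideal.colength_span_singleton_mul hc, Ideal.colength_span_singleton_mul ha,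
    Ideal.colength_span_singleton_mul hd, Ideal.colength_span_singleton_mul ha'] at e1
  rw [Ideal.colength_span_singleton_mul hc, Ideal.colength_span_singleton_mul hd] at e2
  rw [Ideal.colength_span_singleton_mul (pow_mem hc _),
    Ideal.colength_span_singleton_mul (pow_mem hd _), Ideal.colength_span_singleton_pow hc,
    Ideal.colength_span_singleton_pow hd] at e3
  have fin : ∀ {e : A}, e ∈ nonZeroDivisors A → (Ideal.span {e}).colength ≠ ⊤ := fun he =>
    Ideal.colength_ne_top he (Ideal.mem_span_singleton_self _)
  have fI := Ideal.colength_ne_top ha haI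
  have fI' := Ideal.colength_ne_top ha' haI'
  have fIn := Ideal.colength_ne_top (pow_mem ha (n + 1)) (Ideal.pow_mem_pow haI (n + 1))
  have fIn' := Ideal.colength_ne_top (pow_mem ha' (n + 1)) (Ideal.pow_mem_pow haI' (n + 1))
  have fa := fin ha
  have fa' := fin ha'
  have fc := fin hc
  have fd := fin hd
  generalize (Ideal.span {a}).colength = xa at *
  generalize (Ideal.span {a'}).colength = xa' at *
  generalize (Ideal.span {c}).colength = xc at *
  generalize (Ideal.span {d}).colength = xd at *
  generalize I.colength = xI at *
  generalize I'.colength = xI' at *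
  generalize (I ^ (n + 1)).colength = xIn at *
  generalize (I' ^ (n + 1)).colength = xIn' at *
  lift xa to ℕ using fa
  lift xa' to ℕ using fa'
  lift xc to ℕ using fc
  lift xd to ℕ using fd
  lift xI to ℕ using fI
  lift xI' to ℕ using fI'
  lift xIn to ℕ using fIn
  lift xIn' to ℕ using fIn'
  have g4 : sallyLength I a n ≠ ⊤ := by
    intro ht
    rw [ht, top_add] at e4
    exact absurd e4 (by exact_mod_cast (ENat.natCast_ne_top (n * xa + xI)).symm)
  have g5 : sallyLength I' a' n ≠ ⊤ := by
    intro ht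
    rw [ht, top_add] at e5
    exact absurd e5 (by exact_mod_cast (ENat.natCast_ne_top (n * xa' + xI')).symm)
  generalize sallyLength I a n = s at *
  generalize sallyLength I' a' n = s' at *
  lift s to ℕ using g4
  lift s' to ℕ using g5
  norm_cast at e1 e2 e3 e4 e5 ⊢
  have e1' : xc + xa = xd + xa' := by omega
  zify at *
  linear_combination e4 - e5 + e2 + n * e1' - e3

variable [IsLocalRing A]

theorem HasSimpleSocle.length_le_one {M : Type*} [AddCommGroup M] [Module A M]
    (hM : HasSimpleSocle A M) {N : Submodule A M}
    (h : ∀ y ∈ maximalIdeal A, ∀ x ∈ N, y • x = 0) : Module.length A N ≤ 1 := by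
  obtain ⟨s, -, hm, hs⟩ := hM
  let f : (A ⧸ maximalIdeal A) →ₗ[A] M :=
    (maximalIdeal A).liftQ (LinearMap.toSpanSingleton A M s) fun x hx => by simpa using hm x hx
  have hle : N ≤ LinearMap.range f := fun x hx => by
    obtain ⟨r, rfl⟩ := hs x fun y hy => h y hy x hx
    exact ⟨Submodule.Quotient.mk r, rfl⟩
  calc Module.length A N ≤ Module.length A (LinearMap.range f) :=
        Module.length_le_of_injective _ (Submodule.inclusion_injective hle)
    _ ≤ Module.length A (A ⧸ maximalIdeal A) :=
        Module.length_le_of_surjective _ f.surjective_rangeRestrict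
    _ = 1 := by
        have : IsSimpleModule A (A ⧸ maximalIdeal A) :=
          isSimpleModule_iff_quot_maximal.mpr ⟨_, inferInstance, ⟨LinearEquiv.refl A _⟩⟩
        exact Module.length_eq_one A _

open Pointwise in
-- Multiplication by `a` embeds `I ^ (n + 1) / a ^ n I` into `I / a ^ (n + 1) I`. By hypothesis the
-- image is killed by `m`, so it lies in a simple socle.
theorem sallyLength_le_one [IsNoetherianRing A] [Ring.KrullDimLE 1 A] {I : Ideal A} {a : A} {n : ℕ}
    (ha : a ∈ nonZeroDivisors A) (ham : a ∈ maximalIdeal A) (haI : a ∈ I) (hI : I.IsTypeOne)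
    (h : maximalIdeal A * I ^ (n + 1) ≤ Ideal.span {a ^ n} * I) : sallyLength I a n ≤ 1 := by
  -- The extra factor `a` keeps the modulus inside `m` even for `n = 0`.
  have hs := hI (a ^ (n + 1)) (pow_mem ha _) (Ideal.pow_mem_of_mem _ ham _ n.succ_pos)
  let φ : ↥(I ^ (n + 1)) →ₗ[A] I ⧸ (a ^ (n + 1) • ⊤ : Submodule A I) :=
    (Submodule.mkQ _) ∘ₗ ((LinearMap.mulLeft A a).restrict fun x _ => I.mul_mem_right x haI)
  have hφ : ∀ x, φ x = Submodule.Quotient.mk ⟨a * x, I.mul_mem_right _ haI⟩ := fun x => rfl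
  have hker : LinearMap.ker φ = (Ideal.span {a ^ n} * I).submoduleOf (I ^ (n + 1)) := by
    ext x
    rw [LinearMap.mem_ker, hφ, Ideal.mk_smul_top_eq_zero_iff, Submodule.submoduleOf,
      Submodule.mem_comap, Submodule.subtype_apply, Ideal.mem_span_singleton_mul]
    refine exists_congr fun z => and_congr_right fun _ => ?_
    rw [← mul_cancel_left_mem_nonZeroDivisors ha (x := a ^ n * z), pow_succ', mul_assoc]
  rw [sallyLength, ← hker, (LinearMap.quotKerEquivRange φ).length_eq]
  refine hs.length_le_one fun y hy x hx => ?_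
  obtain ⟨x, rfl⟩ := hx
  rw [← map_smul, ← LinearMap.mem_ker, hker]
  exact h (Ideal.mul_mem_mul hy x.2)

/-- For `z ∈ I`, cancelling `a ^ n` in `a ^ n z I ⊆ a ^ (n + 1) I` gives `zI ⊆ aI`, and faithfulness
of `I / aI` puts `z` in `(a)`. The index is `n + 1` because the piece of degree `0` always vanishes.
-/
theorem eq_span_singleton_of_sallyLength_eq_zero [IsNoetherianRing A] [Ring.KrullDimLE 1 A]
    {I : Ideal A} {a : A} {n : ℕ}
    (ha : a ∈ nonZeroDivisors A) (ham : a ∈ maximalIdeal A) (haI : a ∈ I) (hI : I.IsTypeOne)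
    (h : sallyLength I a (n + 1) = 0) : I = Ideal.span {a} := by
  rw [sallyLength_eq_zero_iff haI] at h
  refine le_antisymm (fun z hz => ?_) ((Ideal.span_singleton_le_iff_mem _).mpr haI)
  refine (hI a ha ham).mem_span_singleton_of_forall_mul_mem ha ha haI fun w hw => ?_
  have h1 : a ^ n * (z * w) ∈ Ideal.span {a ^ (n + 1)} * I := by
    rw [← h, pow_succ, pow_succ, mul_assoc]
    exact Ideal.mul_mem_mul (Ideal.pow_mem_pow haI n) (Ideal.mul_mem_mul hz hw)
  obtain ⟨v, hv, h2⟩ := Ideal.mem_span_singleton_mul.mp h1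
  refine Ideal.mem_span_singleton_mul.mpr ⟨v, hv, ?_⟩
  refine (mul_cancel_left_mem_nonZeroDivisors (pow_mem ha n)).mp ?_
  rw [← h2]
  ring

theorem maximalIdeal_mul_le_of_sallyLength_eq_one {I : Ideal A} {a : A} {n : ℕ}
    (h : sallyLength I a n = 1) :
    maximalIdeal A * I ^ (n + 1) ≤ Ideal.span {a ^ n} * I := by
  rw [sallyLength, Module.length_eq_one_iff] at h
  obtain ⟨m, hm, ⟨e⟩⟩ := isSimpleModule_iff_quot_maximal.mp h
  obtain rfl := eq_maximalIdeal hm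
  rw [Ideal.mul_le]
  intro x hx z hz
  have : x • (Submodule.Quotient.mk ⟨z, hz⟩ : ↥(I ^ (n + 1)) ⧸
      (Ideal.span {a ^ n} * I).submoduleOf (I ^ (n + 1))) = 0 := by
    apply e.injective
    rw [map_smul, map_zero]
    obtain ⟨w, hw⟩ := Submodule.Quotient.mk_surjective _ (e (Submodule.Quotient.mk ⟨z, hz⟩))
    rw [← hw, ← Submodule.Quotient.mk_smul, Submodule.Quotient.mk_eq_zero]
    exact Ideal.mul_mem_right _ _ hx
  rw [← Submodule.Quotient.mk_smul, Submodule.Quotient.mk_eq_zero] at this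
  exact this

/-- The same faithfulness argument, applied to the products `yz` with `y ∈ m` and `z ∈ I`. -/
theorem maximalIdeal_mul_le_span_singleton [IsNoetherianRing A] [Ring.KrullDimLE 1 A]
    {I : Ideal A} {a : A} {n : ℕ}
    (ha : a ∈ nonZeroDivisors A) (ham : a ∈ maximalIdeal A) (haI : a ∈ I) (hI : I.IsTypeOne)
    (h : maximalIdeal A * I ^ (n + 1 + 1) ≤ Ideal.span {a ^ (n + 1)} * I) :
    maximalIdeal A * I ≤ Ideal.span {a} := by
  rw [Ideal.mul_le]
  intro y hy z hz
  refine (hI a ha ham).mem_span_singleton_of_forall_mul_mem ha ha haI fun w hw => ?_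
  have h1 : y * (a ^ n * (z * w)) ∈ Ideal.span {a ^ (n + 1)} * I := by
    refine h (Ideal.mul_mem_mul hy ?_)
    rw [pow_succ, pow_succ, mul_assoc]
    exact Ideal.mul_mem_mul (Ideal.pow_mem_pow haI n) (Ideal.mul_mem_mul hz hw)
  obtain ⟨v, hv, h2⟩ := Ideal.mem_span_singleton_mul.mp h1
  refine Ideal.mem_span_singleton_mul.mpr ⟨v, hv, ?_⟩
  refine (mul_cancel_left_mem_nonZeroDivisors (pow_mem ha n)).mp ?_
  linear_combination h2

/-- If `mI ⊆ (i)` for some nonzerodivisor `i ∈ I`, then `m` annihilates the Sally module in high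
degrees. -/
theorem sallyLength_eq_zero_or_maximalIdeal_mul_le {I : Ideal A} {a i : A} {n : ℕ}
    (ha : a ∈ nonZeroDivisors A) (haI : a ∈ I)
    (h : I ^ (n + 1 + 1) = Ideal.span {a} * I ^ (n + 1))
    (hi : i ∈ nonZeroDivisors A) (hiI : i ∈ I) (hm : maximalIdeal A * I ≤ Ideal.span {i}) :
    sallyLength I a n = 0 ∨ maximalIdeal A * I ^ (n + 1) ≤ Ideal.span {a ^ n} * I := by
  -- If `mI ⊆ im`, then `mI = im`; comparing powers through the reduction gives `im = am`, so `mI ^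
  -- k = a ^ k m` for all `k`. Otherwise some `yz` is a unit multiple of `i`, and cancelling `y`
  -- shows `I = (z)`.
  by_cases hmi : maximalIdeal A * I ≤ Ideal.span {i} * maximalIdeal A
  · right
    have heq : maximalIdeal A * I = Ideal.span {i} * maximalIdeal A := by
      refine le_antisymm hmi ?_
      rw [mul_comm]
      exact Ideal.mul_mono_right ((Ideal.span_singleton_le_iff_mem _).mpr hiI)
    have hpow : ∀ k, maximalIdeal A * I ^ k = Ideal.span {i ^ k} * maximalIdeal A := by
      intro k
      induction k with
      | zero => simp
      | succ k ih =>
        rw [pow_succ, ← mul_assoc, ih, mul_assoc, heq, ← mul_assoc,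
          Ideal.span_singleton_mul_span_singleton, ← pow_succ]
    have h1 : Ideal.span {i ^ (n + 1)} * (Ideal.span {i} * maximalIdeal A) =
        Ideal.span {i ^ (n + 1)} * (Ideal.span {a} * maximalIdeal A) := by
      rw [← mul_assoc, Ideal.span_singleton_mul_span_singleton, ← pow_succ, ← hpow, h,
        mul_left_comm, hpow]
      ring
    have h2 : maximalIdeal A * I = Ideal.span {a} * maximalIdeal A := by
      rw [heq]
      exact le_antisymm
        (Ideal.span_singleton_mul_right_inj_of_mem_nonZeroDivisors (pow_mem hi _) h1.le)
        (Ideal.span_singleton_mul_right_inj_of_mem_nonZeroDivisors (pow_mem hi _) h1.ge)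
    have h3 : ∀ k, maximalIdeal A * I ^ k = Ideal.span {a ^ k} * maximalIdeal A := by
      intro k
      induction k with
      | zero => simp
      | succ k ih =>
        rw [pow_succ, ← mul_assoc, ih, mul_assoc, h2, ← mul_assoc,
          Ideal.span_singleton_mul_span_singleton, ← pow_succ]
    rw [h3, pow_succ, ← Ideal.span_singleton_mul_span_singleton, mul_assoc]
    exact Ideal.mul_mono_right (Ideal.mul_le_left.trans
      ((Ideal.span_singleton_le_iff_mem _).mpr haI))
  · left
    rw [Ideal.mul_le] at hmi
    push Not at hmi
    obtain ⟨y, hy, z, hz, hyz⟩ := hmi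
    obtain ⟨r, hr⟩ := Ideal.mem_span_singleton'.mp (hm (Ideal.mul_mem_mul hy hz))
    have hu : IsUnit r := by
      by_contra hu
      refine hyz ?_
      exact Ideal.mem_span_singleton_mul.mpr ⟨r, (mem_maximalIdeal r).mpr hu, by rw [← hr, mul_comm]⟩
    have hyzn : y * z ∈ nonZeroDivisors A := by
      rw [← hr]
      exact mul_mem hu.mem_nonZeroDivisors hi
    have hI : I = Ideal.span {z} := by
      refine le_antisymm (fun w hw => ?_) ((Ideal.span_singleton_le_iff_mem _).mpr hz)
      obtain ⟨q, hq⟩ := Ideal.mem_span_singleton'.mp (hm (Ideal.mul_mem_mul hy hw))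
      obtain ⟨v, hv⟩ := hu.exists_left_inv
      refine Ideal.mem_span_singleton'.mpr ⟨q * v, ?_⟩
      refine (mul_cancel_left_mem_nonZeroDivisors (mul_mem_nonZeroDivisors.mp hyzn).1).mp ?_
      linear_combination hq + q * i * hv - q * v * hr
    exact sallyLength_eq_zero_of_eq_span_singleton ha haI h hI

end Reduction

/-! ### `Ext¹` from a module killed by a regular element. -/

section ExtOne

open Pointwise Abelian

variable {A : Type u} [CommRing A]

/-- The natural map `Hom(X, M / bM) → Ext¹(X, M)` attached to an `M`-regular element `b`. -/
noncomputable def extOneOfHom {M : Type u} [AddCommGroup M] [Module A M] {b : A}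
    (hb : IsSMulRegular (ModuleCat.of A M) b) (X : ModuleCat.{u} A) :
    (X ⟶ ((ModuleCat.of A M).smulShortComplex b).X₃) →ₗ[A] Ext X (ModuleCat.of A M) 1 where
  toFun f := (Ext.mk₀ f).comp hb.smulShortComplex_shortExact.extClass (zero_add 1)
  map_add' f g := by
    rw [Ext.mk₀_add, Ext.add_comp]
    rfl
  map_smul' r f := by
    rw [Ext.mk₀_smul, Ext.smul_comp, RingHom.id_apply]
    rfl

variable {M : Type u} [AddCommGroup M] [Module A M] {b : A}
  (hb : IsSMulRegular (ModuleCat.of A M) b) {X : ModuleCat.{u} A}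

theorem extOneOfHom_comp {X' : ModuleCat.{u} A} (f : X' ⟶ X)
    (g : X ⟶ ((ModuleCat.of A M).smulShortComplex b).X₃) :
    extOneOfHom hb X' (f ≫ g) = (Ext.mk₀ f).comp (extOneOfHom hb X g) (zero_add 1) := by
  exact (Ext.mk₀_comp_mk₀_assoc f g hb.smulShortComplex_shortExact.extClass).symm

/-- The kernel comes from `Hom(X, M)`, which vanishes because `b` kills `X` and is regular on `M`.
-/
theorem extOneOfHom_injective (hX : ∀ x : X, b • x = 0) :
    Function.Injective (extOneOfHom hb X) := by
  rw [injective_iff_map_eq_zero]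
  intro f hf
  obtain ⟨g, hg⟩ := Ext.covariant_sequence_exact₃ X hb.smulShortComplex_shortExact (Ext.mk₀ f)
    (zero_add 1) hf
  obtain ⟨g, rfl⟩ := Ext.mk₀_bijective _ _ |>.2 g
  have hg0 : g = 0 := by
    ext x
    refine hb ?_
    change b • g.hom x = b • (0 : M)
    rw [← map_smul, hX, map_zero, smul_zero]
    rfl
  rw [hg0, Ext.mk₀_zero, Ext.zero_comp] at hg
  exact (Ext.mk₀_bijective _ _).1 (by rw [← hg, Ext.mk₀_zero])

/-- The obstruction is the action of `b` on `Ext¹(X, M)`, which is zero because `b` is zero on `X`.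
-/
theorem extOneOfHom_surjective (hX : ∀ x : X, b • x = 0) :
    Function.Surjective (extOneOfHom hb X) := by
  intro e
  obtain ⟨g, hg⟩ := Ext.covariant_sequence_exact₁ X hb.smulShortComplex_shortExact e (by
    rw [ModuleCat.smulShortComplex_f_eq_smul_id]
    refine (Ext.smul_eq_comp_mk₀ e b).symm.trans ?_
    have h1 : b • (𝟙 X) = 0 := by
      ext x
      exact hX x
    rw [← Ext.mk₀_id_comp e, ← Ext.smul_comp, ← Ext.mk₀_smul, h1, Ext.mk₀_zero, Ext.zero_comp]
    rfl)
    (zero_add 1)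
  obtain ⟨g, rfl⟩ := Ext.mk₀_bijective _ _ |>.2 g
  exact ⟨g, hg⟩

/-- The left side does not involve `b`, so this transfers simple socles from one regular element to
another. -/
theorem length_ext_one_eq_one_iff [IsLocalRing A] {M : Type u} [AddCommGroup M] [Module A M] {b : A}
    (hb : IsSMulRegular M b) (hbm : b ∈ maximalIdeal A) :
    Module.length A (Ext (ModuleCat.of A (A ⧸ maximalIdeal A)) (ModuleCat.of A M) 1) = 1 ↔
      HasSimpleSocle A (M ⧸ (b • ⊤ : Submodule A M)) := by
  rw [← length_hom_quotient_maximalIdeal]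
  have hX : ∀ x : ModuleCat.of A (A ⧸ maximalIdeal A), b • x = 0 := by
    intro x
    obtain ⟨x, rfl⟩ := Submodule.Quotient.mk_surjective _ x
    exact (Submodule.Quotient.mk_eq_zero _).mpr (Ideal.mul_mem_right _ _ hbm)
  rw [← (LinearEquiv.ofBijective _ ⟨extOneOfHom_injective hb hX,
    extOneOfHom_surjective hb hX⟩).length_eq]
  exact (ModuleCat.homLinearEquiv (S := A) (M := ModuleCat.of A (A ⧸ maximalIdeal A))
    (N := ModuleCat.of A (M ⧸ (b • ⊤ : Submodule A M)))).length_eq ▸ Iff.rfl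

end ExtOne

/-! ### Finite self-injective dimension implies type one. -/

section InjectiveDimension

open Pointwise Abelian

variable {A : Type u} [CommRing A]

theorem ModuleCat.shortExact_of_submodule {N : Type u} [AddCommGroup N] [Module A N]
    (N' : Submodule A N) :
    (ModuleCat.shortComplexOfCompEqZero N'.subtype N'.mkQ
      (LinearMap.exact_subtype_mkQ N').linearMap_comp_eq_zero).ShortExact :=
  ModuleCat.shortComplex_shortExact _ (LinearMap.exact_subtype_mkQ N') N'.subtype_injective
    N'.mkQ_surjective

theorem ext_eq_zero_of_linearEquiv {Y : ModuleCat.{u} A} {n : ℕ} {N N' : Type u}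
    [AddCommGroup N] [Module A N] [AddCommGroup N'] [Module A N'] (i : N ≃ₗ[A] N')
    (h : ∀ e : Ext (ModuleCat.of A N) Y n, e = 0) (e : Ext (ModuleCat.of A N') Y n) : e = 0 := by
  have h2 : (Ext.mk₀ i.symm.toModuleIso.hom).comp
      ((Ext.mk₀ i.toModuleIso.hom).comp e (zero_add n)) (zero_add n) = e := by
    rw [Ext.mk₀_comp_mk₀_assoc]
    have : i.symm.toModuleIso.hom ≫ i.toModuleIso.hom = 𝟙 _ := i.toModuleIso.inv_hom_id
    rw [this, Ext.mk₀_id_comp]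
  rw [← h2, h ((Ext.mk₀ i.toModuleIso.hom).comp e (zero_add n)), Ext.comp_zero]

theorem ext_eq_zero_of_isFiniteLength [IsLocalRing A] {Y : ModuleCat.{u} A} {n : ℕ}
    (h : ∀ e : Ext (ModuleCat.of A (A ⧸ maximalIdeal A)) Y n, e = 0)
    {N : Type u} [AddCommGroup N] [Module A N] (hN : IsFiniteLength A N)
    (e : Ext (ModuleCat.of A N) Y n) : e = 0 := by
  induction hN with
  | @of_subsingleton N _ _ _ =>
    have h0 : (𝟙 (ModuleCat.of A N)) = 0 := by
      ext x
      exact Subsingleton.elim (α := N) _ _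
    rw [← Ext.mk₀_id_comp e, h0, Ext.mk₀_zero, Ext.zero_comp]
  | @of_simple_quotient N _ _ N' hs _ ih =>
    obtain ⟨e', rfl⟩ := Ext.contravariant_sequence_exact₂ (ModuleCat.shortExact_of_submodule N') Y e
      (ih _)
    obtain ⟨m, hm, ⟨i⟩⟩ := isSimpleModule_iff_quot_maximal.mp hs
    obtain rfl := eq_maximalIdeal hm
    have h0 : e' = 0 := ext_eq_zero_of_linearEquiv i.symm h e'
    rw [h0, Ext.comp_zero]

/-- If `Ext^n(X, Y) = 0` for `n ≥ n₀`, where the nonzero module `X` has finite length, and `Y` has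
finite injective dimension, then `Ext^n(N, Y) = 0` for `n ≥ n₀` and all `N` of finite length. -/
theorem ext_eq_zero_of_injectiveDimension_lt_top [IsLocalRing A] {Y : ModuleCat.{u} A}
    (hY : injectiveDimension Y < ⊤) {X : Type u} [AddCommGroup X] [Module A X] [Nontrivial X]
    (hX : IsFiniteLength A X) {n₀ : ℕ}
    (h : ∀ n, n₀ ≤ n → ∀ e : Ext (ModuleCat.of A X) Y n, e = 0)
    {N : Type u} [AddCommGroup N] [Module A N] (hN : IsFiniteLength A N)
    (e : Ext (ModuleCat.of A N) Y n₀) : e = 0 := by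
  obtain ⟨_, _⟩ := isFiniteLength_iff_isNoetherian_isArtinian.mp hX
  obtain ⟨S, hS, -⟩ := (eq_bot_or_exists_atom_le (⊤ : Submodule A X)).resolve_left top_ne_bot
  have hsimple : IsSimpleModule A S := isSimpleModule_iff_isAtom.mpr hS
  obtain ⟨m, hm, ⟨i⟩⟩ := isSimpleModule_iff_quot_maximal.mp hsimple
  obtain rfl := eq_maximalIdeal hm
  obtain ⟨d, hd⟩ := (injectiveDimension_ne_top_iff Y).mp hY.ne
  -- Downward induction on `n` from the range above the injective dimension. A simple `S ⊆ X` is the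
  -- residue field, and `Ext^n(S, Y)` sits between `Ext^n(X, Y) = 0` and `Ext^(n+1)(X / S, Y) = 0`.
  suffices H : ∀ k n, n₀ ≤ n → d + 1 ≤ n + k → ∀ {N : Type u} [AddCommGroup N] [Module A N],
      IsFiniteLength A N → ∀ e : Ext (ModuleCat.of A N) Y n, e = 0 from
    H (d + 1) n₀ le_rfl (by omega) hN e
  intro k
  induction k with
  | zero =>
    intro n _ hn N _ _ _ e
    exact e.eq_zero_of_hasInjectiveDimensionLT (d + 1) hn
  | succ k ih =>
    intro n hn hnk N _ _ hN e
    refine ext_eq_zero_of_isFiniteLength (fun e => ?_) hN e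
    have hex := ModuleCat.shortExact_of_submodule S
    refine ext_eq_zero_of_linearEquiv i (fun e' => ?_) e
    obtain ⟨x, hx⟩ := Ext.contravariant_sequence_exact₁ hex Y e' (add_comm 1 n)
      (ih (n + 1) (by omega) (by omega) (hX.of_surjective S.mkQ_surjective) _)
    rw [← hx, h n hn x, Ext.comp_zero]

/-- A socle element `t` defines a map `S → X` with `s ↦ t` on a simple `S = As`. Its extension to
the cyclic module `X` is multiplication by a scalar, so `t ∈ As`. -/
theorem hasSimpleSocle_of_forall_exists_extension [IsLocalRing A] {X : Type u} [AddCommGroup X]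
    [Module A X] [Nontrivial X] (hX : IsFiniteLength A X) {x₀ : X}
    (hx₀ : ∀ x : X, ∃ r : A, r • x₀ = x)
    (h : ∀ (S : Submodule A X) [IsSimpleModule A S] (f : S →ₗ[A] X),
      ∃ g : X →ₗ[A] X, ∀ x : S, g x = f x) : HasSimpleSocle A X := by
  obtain ⟨_, _⟩ := isFiniteLength_iff_isNoetherian_isArtinian.mp hX
  obtain ⟨S, hS, -⟩ := (eq_bot_or_exists_atom_le (⊤ : Submodule A X)).resolve_left top_ne_bot
  have hsimple : IsSimpleModule A S := isSimpleModule_iff_isAtom.mpr hS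
  obtain ⟨m, hm, ⟨i⟩⟩ := isSimpleModule_iff_quot_maximal.mp hsimple
  obtain rfl := eq_maximalIdeal hm
  let s : S := i.symm (Submodule.Quotient.mk 1)
  have hsi : i s = Submodule.Quotient.mk 1 := i.apply_symm_apply _
  refine ⟨s, fun h0 => ?_, fun x hx => ?_, fun t ht => ?_⟩
  · have h1 : s = 0 := Subtype.ext h0
    rw [h1, map_zero, eq_comm, Submodule.Quotient.mk_eq_zero] at hsi
    exact (Ideal.ne_top_iff_one _).mp hm.ne_top hsi
  · have h1 : x • s = 0 := by
      apply i.injective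
      rw [map_smul, hsi, map_zero, ← Submodule.Quotient.mk_smul, Submodule.Quotient.mk_eq_zero]
      exact Ideal.mul_mem_right _ _ hx
    exact congrArg Subtype.val h1
  · let f : S →ₗ[A] X := (maximalIdeal A).liftQ (LinearMap.toSpanSingleton A X t)
      (fun x hx => by simpa using ht x hx) ∘ₗ i.toLinearMap
    obtain ⟨g, hg⟩ := h S f
    have hfs : f s = t := by
      simp only [f, LinearMap.comp_apply, LinearEquiv.coe_coe, hsi]
      exact one_smul A t
    obtain ⟨q, hq⟩ := hx₀ (g x₀)
    obtain ⟨r, hr⟩ := hx₀ s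
    refine ⟨q, ?_⟩
    rw [← hfs, ← hg, ← hr, map_smul, ← hq, smul_comm]

/-- A local Artinian ring of finite self-injective dimension has simple socle. -/
theorem IsGorensteinLocalRing.hasSimpleSocle [IsLocalRing A] [IsArtinianRing A]
    (h : IsGorensteinLocalRing A) : HasSimpleSocle A A := by
  have hfin : IsFiniteLength A A := 
    isFiniteLength_iff_isNoetherian_isArtinian.mpr ⟨inferInstance, inferInstance⟩
  refine hasSimpleSocle_of_forall_exists_extension hfin (x₀ := 1) (fun x => ⟨x, by simp⟩)
    fun S _ f => ?_
  obtain ⟨x, hx⟩ := Ext.contravariant_sequence_exact₁ (ModuleCat.shortExact_of_submodule S)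
    (ModuleCat.of A A) (Ext.mk₀ (ModuleCat.ofHom f)) (add_zero 1)
    (ext_eq_zero_of_injectiveDimension_lt_top h.injectiveDimension_lt_top hfin (fun n hn e => by
      obtain ⟨k, rfl⟩ := Nat.exists_eq_add_of_le' hn
      have : Projective (ModuleCat.of A A) := inferInstance
      exact e.eq_zero_of_projective) (hfin.of_surjective S.mkQ_surjective) _)
  obtain ⟨g, rfl⟩ := Ext.mk₀_bijective _ _ |>.2 x
  rw [Ext.mk₀_comp_mk₀] at hx
  have := (Ext.mk₀_bijective _ _).1 hx
  exact ⟨g.hom, fun y => LinearMap.congr_fun (congrArg ModuleCat.Hom.hom this) y⟩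

/-- A one-dimensional Cohen-Macaulay local ring of finite self-injective dimension has type one. -/
theorem IsGorensteinLocalRing.isTypeOne_top [IsOneDimCMLocalRing A]
    (h : IsGorensteinLocalRing A) : (⊤ : Ideal A).IsTypeOne := by
  intro b hb hbm
  have hreg : IsSMulRegular (ModuleCat.of A A) b := isSMulRegular_of_mem_nonZeroDivisors hb
  have hspan : (b • ⊤ : Submodule A A) = Ideal.span {b} := by
    rw [← Submodule.ideal_span_singleton_smul, smul_eq_mul, Ideal.mul_top]
  have hfin : IsFiniteLength A (A ⧸ (b • ⊤ : Submodule A A)) := by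
    rw [hspan]
    exact isFiniteLength_quotient_span_singleton A hb
  have : Nontrivial (A ⧸ (b • ⊤ : Submodule A A)) := by
    rw [Submodule.Quotient.nontrivial_iff, hspan, Ne, Ideal.span_singleton_eq_top]
    exact (mem_maximalIdeal b).mp hbm
  suffices H : HasSimpleSocle A (A ⧸ (b • ⊤ : Submodule A A)) by
    refine H.congr (Submodule.Quotient.equiv _ _ (Submodule.topEquiv (R := A) (M := A)).symm ?_)
    ext x
    simp only [Submodule.mem_map, Submodule.mem_smul_pointwise_iff_exists]
    constructor
    · rintro ⟨_, ⟨y, -, rfl⟩, rfl⟩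
      exact ⟨⟨y, trivial⟩, trivial, rfl⟩
    · rintro ⟨y, -, rfl⟩
      exact ⟨_, ⟨y, trivial, rfl⟩, rfl⟩
  refine hasSimpleSocle_of_forall_exists_extension hfin (x₀ := Submodule.Quotient.mk 1)
    (fun x => ?_) fun S _ f => ?_
  · obtain ⟨x, rfl⟩ := Submodule.Quotient.mk_surjective _ x
    exact ⟨x, by rw [← Submodule.Quotient.mk_smul, smul_eq_mul, mul_one]⟩
  have hkill : ∀ x : A ⧸ (b • ⊤ : Submodule A A), b • x = 0 := fun x => by
    obtain ⟨x, rfl⟩ := Submodule.Quotient.mk_surjective _ x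
    rw [← Submodule.Quotient.mk_smul, Submodule.Quotient.mk_eq_zero]
    exact Submodule.smul_mem_pointwise_smul _ _ _ trivial
  have hproj : Projective (ModuleCat.of A A) := inferInstance
  have hproj₁ : Projective ((ModuleCat.of A A).smulShortComplex b).X₁ := hproj
  have hproj₂ : Projective ((ModuleCat.of A A).smulShortComplex b).X₂ := hproj
  let φ : ModuleCat.of A S ⟶ ((ModuleCat.of A A).smulShortComplex b).X₃ := ModuleCat.ofHom f
  -- Maps into `A / b` are read as classes in `Ext¹(-, A)`. Such a class extends from `S` to `A / b`
  -- because `Ext²((A / b) / S, A) = 0`; the modules `Ext^n(A / b, A)` with `n ≥ 2` vanish by the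
  -- free resolution of `A / b`.
  obtain ⟨x, hx⟩ := Ext.contravariant_sequence_exact₁ (ModuleCat.shortExact_of_submodule S)
    (ModuleCat.of A A) (extOneOfHom hreg _ φ) (show 1 + 1 = 2 from rfl)
    (ext_eq_zero_of_injectiveDimension_lt_top h.injectiveDimension_lt_top hfin (fun n hn e => by
      obtain ⟨k, rfl⟩ := Nat.exists_eq_add_of_le' hn
      obtain ⟨e', rfl⟩ := Ext.contravariant_sequence_exact₃ hreg.smulShortComplex_shortExact
        (ModuleCat.of A A) e (Ext.eq_zero_of_projective (n := k + 1) _)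
        (show 1 + (k + 1) = k + 2 by omega)
      rw [Ext.eq_zero_of_projective e', Ext.comp_zero]
      rfl)
      (hfin.of_surjective S.mkQ_surjective) _)
  obtain ⟨g, rfl⟩ := extOneOfHom_surjective hreg hkill x
  have hx' : extOneOfHom hreg (ModuleCat.of A S) (ModuleCat.ofHom S.subtype ≫ g) =
      extOneOfHom hreg _ φ := by
    rw [extOneOfHom_comp]
    exact hx
  have := extOneOfHom_injective hreg (X := ModuleCat.of A S)
    (fun x => Subtype.ext (hkill x)) hx'
  exact ⟨g.hom, fun y => LinearMap.congr_fun (congrArg ModuleCat.Hom.hom this) y⟩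

end InjectiveDimension

/-! ### Type one implies finite injective dimension. -/

section Baer

open Pointwise

variable {A : Type u} [CommRing A]

theorem Module.Finite.exists_pow_smul_mem {W X : Type*} [AddCommGroup W] [Module A W]
    [AddCommGroup X] [Module A X] [Module.Finite A W] (b : A) (Y : Submodule A X)
    (h : ∀ x : X, ∃ k, b ^ k • x ∈ Y) (g : W →ₗ[A] X) : ∃ k, ∀ w, b ^ k • g w ∈ Y := by
  obtain ⟨S, hS⟩ := (Module.Finite.fg_top : (⊤ : Submodule A W).FG)
  choose k hk using h
  refine ⟨S.sup fun w => k (g w), fun w => ?_⟩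
  have hw : w ∈ Submodule.span A (S : Set W) := hS ▸ Submodule.mem_top
  induction hw using Submodule.span_induction with
  | mem x hx =>
    have hle : k (g x) ≤ S.sup fun w => k (g w) := Finset.le_sup (f := fun w => k (g w)) hx
    rw [← Nat.sub_add_cancel hle, pow_add, mul_smul]
    exact Y.smul_mem _ (hk _)
  | zero => simp
  | add x y _ _ hx hy =>
    rw [map_add, smul_add]
    exact Y.add_mem hx hy
  | smul r x _ hx =>
    rw [map_smul, smul_comm]
    exact Y.smul_mem _ hx

theorem IsLocalization.Away.pow_invSelf_mul {b : A} {Q : Type*} [CommRing Q] [Algebra A Q]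
    [IsLocalization.Away b Q] (n : ℕ) :
    algebraMap A Q (b ^ n) * IsLocalization.Away.invSelf b ^ n = 1 := by
  rw [map_pow, ← mul_pow, IsLocalization.Away.mul_invSelf, one_pow]

theorem IsLocalization.Away.exists_pow_smul_mem_map {b : A} {J : Ideal A} {Q : Type*} [CommRing Q]
    [Algebra A Q] [IsLocalization.Away b Q] (hbJ : b ∈ J) (q : Q) :
    ∃ k, b ^ k • q ∈ Submodule.map (Algebra.linearMap A Q) J := by
  obtain ⟨k, x, hx⟩ := IsLocalization.Away.surj b q
  refine ⟨k + 1, b * x, J.mul_mem_right x hbJ, ?_⟩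
  rw [Algebra.linearMap_apply, map_mul, ← hx, Algebra.smul_def, map_pow]
  ring

variable [IsLocalRing A] [IsNoetherianRing A] [Ring.KrullDimLE 1 A]
  {J : Ideal A} {b : A}

/-- A uniform version of `HasSimpleSocle.exists_eq_smul` for the quotients `J / b ^ n J`, with a
shift provided by the Artin-Rees lemma. -/
theorem Ideal.IsTypeOne.exists_smul_eq_smul (hJ : J.IsTypeOne) (hb : b ∈ nonZeroDivisors A)
    (hbm : b ∈ maximalIdeal A) (hbJ : b ∈ J) (P : Ideal A) :
    ∃ k, ∀ n, ∀ f : P →ₗ[A] J ⧸ (b ^ n • ⊤ : Submodule A J),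
      ∃ y : J, ∀ (x : P) (z : J), f x = Submodule.Quotient.mk z →
        ∃ w ∈ J, b ^ k * (z : A) = x * y + b ^ (n + k) * w := by
  obtain ⟨k, hk⟩ := Ideal.exists_pow_inf_eq_pow_smul (Ideal.span {b}) P
  -- One more than the Artin-Rees constant, so that `b ^ (n + (k + 1))` lies in `m` even when `n =
  -- 0` and `k = 0`.
  refine ⟨k + 1, fun n f => ?_⟩
  have hbn : b ^ (n + (k + 1)) ∈ nonZeroDivisors A := pow_mem hb _
  have hle : (b ^ n • ⊤ : Submodule A J) ≤
      (b ^ (n + (k + 1)) • ⊤ : Submodule A J).comap (LinearMap.lsmul A J (b ^ (k + 1))) := by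
    intro x hx
    obtain ⟨y, -, rfl⟩ := (Submodule.mem_smul_pointwise_iff_exists _ _ _).mp hx
    rw [Submodule.mem_comap, LinearMap.lsmul_apply, smul_smul, ← pow_add, add_comm (k + 1)]
    exact Submodule.smul_mem_pointwise_smul _ _ _ trivial
  let μ : (J ⧸ (b ^ n • ⊤ : Submodule A J)) →ₗ[A] J ⧸ (b ^ (n + (k + 1)) • ⊤ : Submodule A J) :=
    Submodule.mapQ _ _ _ hle
  have hμ : ∀ z, μ (Submodule.Quotient.mk z) = Submodule.Quotient.mk (b ^ (k + 1) • z) :=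
    fun z => rfl
  obtain ⟨y, hy⟩ := (hJ _ hbn (Ideal.pow_mem_of_mem _ hbm _ (by omega))).exists_eq_smul hbn hb hbJ P
    (μ ∘ₗ f) fun x hx => by
      have hx' : (x : A) ∈ Ideal.span {b} ^ (n + (k + 1)) • (⊤ : Submodule A A) ⊓ P := by
        refine ⟨?_, x.2⟩
        rwa [smul_eq_mul, Ideal.mul_top, Ideal.span_singleton_pow]
      rw [hk _ (by omega), show n + (k + 1) - k = n + 1 by omega, Ideal.span_singleton_pow,
        smul_eq_mul, Ideal.mem_span_singleton_mul] at hx'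
      obtain ⟨v, hv, hv'⟩ := hx'
      have hx2 : x = (b ^ n) • (⟨b * v, P.mul_mem_left b hv.2⟩ : P) := by
        apply Subtype.ext
        rw [← hv', SetLike.val_smul, smul_eq_mul]
        ring
      rw [LinearMap.comp_apply, hx2, map_smul, Ideal.smul_quotient_smul_top_eq_zero
        (Ideal.mem_span_singleton_self _), map_zero]
  refine ⟨y, fun x z hz => ?_⟩
  have h1 := hy x
  rw [LinearMap.comp_apply, hz, hμ, ← sub_eq_zero, ← Submodule.Quotient.mk_sub,
    Ideal.mk_smul_top_eq_zero_iff] at h1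
  obtain ⟨w, hw, h1⟩ := h1
  refine ⟨w, hw, ?_⟩
  simp only [Submodule.coe_sub, SetLike.val_smul, smul_eq_mul] at h1
  linear_combination -h1

/-- A linear map from an ideal to `J` becomes multiplication by an element of `J` after
multiplication by a power of `b`. -/
theorem Ideal.IsTypeOne.exists_pow_mul_eq_mul (hJ : J.IsTypeOne) (hb : b ∈ nonZeroDivisors A)
    (hbm : b ∈ maximalIdeal A) (hbJ : b ∈ J) {P : Ideal A} (f : P →ₗ[A] J) :
    ∃ (k : ℕ) (y : J), ∀ x : P, b ^ k * (f x : A) = x * y := by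
  obtain ⟨k, hk⟩ := hJ.exists_smul_eq_smul hb hbm hbJ P
  let m : J →ₗ[A] P →ₗ[A] J := LinearMap.lsmul A J |>.flip.domRestrict₂ P |>.restrictScalars A
  refine ⟨k, ?_⟩
  -- By the Krull intersection theorem in the cokernel of `m`, it is enough that for every `n` some
  -- `b ^ k • f - m y` is divisible by `b ^ n`.
  suffices b ^ k • f ∈ LinearMap.range m by
    obtain ⟨y, hy⟩ := this
    exact ⟨y, fun x => (congrArg Subtype.val (LinearMap.congr_fun hy x)).symm⟩
  have hbt : Ideal.span {b} ≠ ⊤ := by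
    rw [Ne, Ideal.span_singleton_eq_top]
    exact hbm
  have hbot := Ideal.iInf_pow_smul_eq_bot_of_isLocalRing
    (M := (P →ₗ[A] J) ⧸ LinearMap.range m) (Ideal.span {b}) hbt
  rw [← Submodule.Quotient.mk_eq_zero, ← Submodule.mem_bot A, ← hbot, Submodule.mem_iInf]
  intro n
  obtain ⟨y, hy⟩ := hk n (Submodule.mkQ _ ∘ₗ f)
  have hdiv : ∀ x : P, ∃ w : J, b ^ n • w = (b ^ k • f - m y) x := by
    intro x
    obtain ⟨w, hw, h⟩ := hy x (f x) rfl
    refine ⟨⟨b ^ k * w, J.mul_mem_left _ hw⟩, Subtype.ext ?_⟩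
    change b ^ n * (b ^ k * w) = b ^ k * (f x : A) - x * y
    linear_combination -h
  choose w hw using hdiv
  have hreg : IsSMulRegular J (b ^ n) := isSMulRegular_ideal_of_mem_nonZeroDivisors (pow_mem hb n) J
  let h : P →ₗ[A] J :=
    { toFun := w
      map_add' := fun u v => hreg (by simp only [smul_add, hw, map_add])
      map_smul' := fun r u => hreg (by
        simp only [RingHom.id_apply, smul_comm (b ^ n) r, hw, map_smul]) }
  have hh : b ^ k • f = m y + b ^ n • h := by
    ext x : 1
    rw [LinearMap.add_apply, LinearMap.smul_apply (b ^ n)]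
    change _ = _ + b ^ n • w x
    rw [hw, LinearMap.sub_apply, add_sub_cancel]
  have hmy : (Submodule.Quotient.mk (m y) : (P →ₗ[A] J) ⧸ LinearMap.range m) = 0 :=
    (Submodule.Quotient.mk_eq_zero _).mpr (LinearMap.mem_range_self m y)
  rw [hh, Submodule.Quotient.mk_add, hmy, zero_add, Submodule.Quotient.mk_smul]
  exact Submodule.smul_mem_smul (Ideal.pow_mem_pow (Ideal.mem_span_singleton_self b) n) trivial

/-- `P` is finitely generated, so a power of `b` carries the map into `J`. There a further power
turns it into multiplication by some `y`, and both powers are inverted in `Q`. -/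
theorem Ideal.IsTypeOne.baer_away (hJ : J.IsTypeOne) (hb : b ∈ nonZeroDivisors A)
    (hbm : b ∈ maximalIdeal A) (hbJ : b ∈ J) (Q : Type u) [CommRing Q] [Algebra A Q]
    [IsLocalization.Away b Q] : Module.Baer A Q := by
  intro P g
  have hinj : Function.Injective (algebraMap A Q) :=
    IsLocalization.injective Q (Submonoid.powers_le.mpr hb)
  obtain ⟨k, hk⟩ := Module.Finite.exists_pow_smul_mem b
    (Submodule.map (Algebra.linearMap A Q) J)
    (IsLocalization.Away.exists_pow_smul_mem_map hbJ) g
  choose f hfJ hf using hk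
  let f' : P →ₗ[A] J :=
    { toFun := fun x => ⟨f x, hfJ x⟩
      map_add' := fun u v => Subtype.ext (hinj (by
        have h1 := hf (u + v)
        have h2 := hf u
        have h3 := hf v
        simp only [Algebra.linearMap_apply] at h1 h2 h3
        simp only [Submodule.coe_add, map_add, h1, h2, h3, smul_add]))
      map_smul' := fun r u => Subtype.ext (hinj (by
        have h1 := hf (r • u)
        have h2 := hf u
        simp only [Algebra.linearMap_apply] at h1 h2
        simp only [RingHom.id_apply, SetLike.val_smul, smul_eq_mul, map_mul, h1, h2, map_smul,
          Algebra.smul_def, mul_left_comm])) }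
  obtain ⟨l, y, hy⟩ := hJ.exists_pow_mul_eq_mul hb hbm hbJ f'
  refine ⟨LinearMap.toSpanSingleton A Q
    (IsLocalization.Away.invSelf b ^ (l + k) * algebraMap A Q y), fun x hx => ?_⟩
  have h1 : algebraMap A Q (b ^ l) * (algebraMap A Q (b ^ k) * g ⟨x, hx⟩) =
      algebraMap A Q x * algebraMap A Q y := by
    have h2 := hf ⟨x, hx⟩
    rw [Algebra.smul_def, Algebra.linearMap_apply] at h2
    rw [← h2, ← map_mul, ← map_mul]
    exact congrArg _ (hy ⟨x, hx⟩)
  have h3 := IsLocalization.Away.pow_invSelf_mul (A := A) (b := b) (Q := Q) (l + k)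
  rw [LinearMap.toSpanSingleton_apply, Algebra.smul_def]
  rw [pow_add, map_mul] at h3
  linear_combination (-IsLocalization.Away.invSelf b ^ (l + k)) * h1 + (g ⟨x, hx⟩) * h3

/-- Some `b ^ n` kills the image of the finitely generated `P`, so the map lands in `b ^ (-n) J /
J`, a copy of `J / b ^ n J`. There it is a multiplication up to the Artin-Rees shift, which is again
inverted in `Q`. -/
theorem Ideal.IsTypeOne.baer_away_quotient (hJ : J.IsTypeOne) (hb : b ∈ nonZeroDivisors A)
    (hbm : b ∈ maximalIdeal A) (hbJ : b ∈ J) (Q : Type u) [CommRing Q] [Algebra A Q]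
    [IsLocalization.Away b Q] :
    Module.Baer A (Q ⧸ Submodule.map (Algebra.linearMap A Q) J) := by
  set K := Submodule.map (Algebra.linearMap A Q) J
  intro P g
  have hinj : Function.Injective (algebraMap A Q) :=
    IsLocalization.injective Q (Submonoid.powers_le.mpr hb)
  have hinv := IsLocalization.Away.pow_invSelf_mul (A := A) (b := b) (Q := Q)
  set v : Q := IsLocalization.Away.invSelf b
  -- division by `b ^ n`
  let θ₀ : ℕ → J →ₗ[A] Q := fun n => LinearMap.mulLeft A (v ^ n) ∘ₗ Algebra.linearMap A Q ∘ₗ J.subtype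
  have hθ₀ : ∀ n j, θ₀ n j = v ^ n * algebraMap A Q j := fun n j => rfl
  let θ : ∀ n, (J ⧸ (b ^ n • ⊤ : Submodule A J)) →ₗ[A] Q ⧸ K := fun n =>
    Submodule.mapQ _ _ (θ₀ n) fun x hx => by
      obtain ⟨y, -, rfl⟩ := (Submodule.mem_smul_pointwise_iff_exists _ _ _).mp hx
      refine ⟨y, y.2, ?_⟩
      rw [hθ₀, Algebra.linearMap_apply, SetLike.val_smul, smul_eq_mul, map_mul]
      linear_combination -(algebraMap A Q y) * hinv n
  have hθ : ∀ n j, θ n (Submodule.Quotient.mk j) =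
    Submodule.Quotient.mk (v ^ n * algebraMap A Q j) := fun n j => rfl
  have hθinj : ∀ n, Function.Injective (θ n) := fun n => by
    rw [injective_iff_map_eq_zero]
    intro x hx
    obtain ⟨x, rfl⟩ := Submodule.Quotient.mk_surjective _ x
    rw [hθ, Submodule.Quotient.mk_eq_zero] at hx
    obtain ⟨z, hz, h⟩ := hx
    rw [Ideal.mk_smul_top_eq_zero_iff]
    refine ⟨z, hz, hinj ?_⟩
    rw [map_mul]
    rw [Algebra.linearMap_apply] at h
    linear_combination algebraMap A Q (b ^ n) * h + (algebraMap A Q x) * hinv n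
  obtain ⟨n, hn⟩ := Module.Finite.exists_pow_smul_mem b (⊥ : Submodule A (Q ⧸ K)) (fun x => by
    obtain ⟨q, rfl⟩ := Submodule.Quotient.mk_surjective _ x
    obtain ⟨k, hk⟩ := IsLocalization.Away.exists_pow_smul_mem_map hbJ q
    exact ⟨k, by rwa [Submodule.mem_bot, ← Submodule.Quotient.mk_smul,
      Submodule.Quotient.mk_eq_zero]⟩) g
  have hrange : ∀ x, g x ∈ LinearMap.range (θ n) := fun x => by
    obtain ⟨q, hq⟩ := Submodule.Quotient.mk_surjective _ (g x)
    have h1 := hn x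
    rw [← hq, Submodule.mem_bot, ← Submodule.Quotient.mk_smul, Submodule.Quotient.mk_eq_zero] at h1
    obtain ⟨z, hz, h⟩ := h1
    refine ⟨Submodule.Quotient.mk ⟨z, hz⟩, ?_⟩
    rw [hθ, ← hq]
    congr 1
    rw [Algebra.linearMap_apply, Algebra.smul_def] at h
    linear_combination v ^ n * h + q * hinv n
  obtain ⟨k, hk⟩ := hJ.exists_smul_eq_smul hb hbm hbJ P
  let f : P →ₗ[A] J ⧸ (b ^ n • ⊤ : Submodule A J) :=
    (LinearEquiv.ofInjective (θ n) (hθinj n)).symm.toLinearMap ∘ₗ g.codRestrict _ hrange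
  have hf : ∀ x, θ n (f x) = g x := fun x =>
    congrArg Subtype.val ((LinearEquiv.ofInjective (θ n) (hθinj n)).apply_symm_apply
      (g.codRestrict _ hrange x))
  obtain ⟨y, hy⟩ := hk n f
  refine ⟨LinearMap.toSpanSingleton A _ (Submodule.Quotient.mk (v ^ (n + k) * algebraMap A Q y)),
    fun x hx => ?_⟩
  obtain ⟨z, hz⟩ := Submodule.Quotient.mk_surjective _ (f ⟨x, hx⟩)
  obtain ⟨w, hw, h⟩ := hy ⟨x, hx⟩ z hz.symm
  rw [LinearMap.toSpanSingleton_apply, ← hf, ← hz, hθ, ← Submodule.Quotient.mk_smul, eq_comm,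
    Submodule.Quotient.eq]
  refine ⟨w, hw, ?_⟩
  have h2 := congrArg (algebraMap A Q) h
  simp only [map_add, map_mul] at h2
  rw [Algebra.linearMap_apply, Algebra.smul_def]
  have h3 := hinv (n + k)
  have h4 := hinv k
  linear_combination -(v ^ (n + k)) * h2 - (algebraMap A Q w) * h3 +
    v ^ n * (algebraMap A Q z) * h4

/-- An ideal of type one containing a nonzerodivisor has injective dimension at most one. -/
theorem Ideal.IsTypeOne.injectiveDimension_lt_top (hJ : J.IsTypeOne) (hb : b ∈ nonZeroDivisors A)
    (hbm : b ∈ maximalIdeal A) (hbJ : b ∈ J) :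
    injectiveDimension (ModuleCat.of A J) < ⊤ := by
  -- An injective resolution of length one: `0 → J → A_b → A_b / J → 0`.
  let Q := Localization.Away b
  let f : J →ₗ[A] Q := Algebra.linearMap A Q ∘ₗ J.subtype
  have hinj : Function.Injective f :=
    (IsLocalization.injective Q (Submonoid.powers_le.mpr hb)).comp Subtype.val_injective
  let K := Submodule.map (Algebra.linearMap A Q) J
  have hex : Function.Exact f K.mkQ := by
    rw [LinearMap.exact_iff, Submodule.ker_mkQ, LinearMap.range_comp, Submodule.range_subtype]
  have := (hJ.baer_away hb hbm hbJ Q).injective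
  have := (hJ.baer_away_quotient hb hbm hbJ Q).injective
  have hQ : Injective (ModuleCat.of A Q) := Module.injective_object_of_injective_module A Q
  have hK : Injective (ModuleCat.of A (Q ⧸ K)) :=
    Module.injective_object_of_injective_module A (Q ⧸ K)
  have hS := ModuleCat.shortComplex_shortExact
    (ModuleCat.shortComplexOfCompEqZero f K.mkQ hex.linearMap_comp_eq_zero) hex hinj K.mkQ_surjective
  have hlt : HasInjectiveDimensionLT (ModuleCat.of A J) 2 :=
    hS.hasInjectiveDimensionLT_X₁ 1 (inferInstanceAs (HasInjectiveDimensionLT (ModuleCat.of A (Q ⧸ K)) 1))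
      (inferInstanceAs (HasInjectiveDimensionLT (ModuleCat.of A Q) (1 + 1)))
  exact lt_of_lt_of_le (injectiveDimension_lt_iff.mpr hlt) le_top

end Baer

/-! ### Canonical ideals are ideals of type one. -/

section CanonicalIdeal

variable {A : Type u} [CommRing A] [IsOneDimCMLocalRing A]

theorem IsCanonicalModule.isSMulRegular {M : Type u} [AddCommGroup M] [Module A M]
    (h : IsCanonicalModule A M) {a : A} (ha : IsParameter a) : IsSMulRegular M a := by
  obtain ⟨rs, hrs, hl, -⟩ := h.exists_isRegular_and_length_ext
  obtain ⟨r, rfl⟩ := length_eq_one_of_cast_eq_ringKrullDim hl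
  obtain ⟨hr, hr'⟩ := hrs.mem_maximalIdeal_and_isSMulRegular
  exact ha.isSMulRegular hr hr'

theorem IsCanonicalModule.length_ext_eq_one {M : Type u} [AddCommGroup M] [Module A M]
    (h : IsCanonicalModule A M) : Module.length A
      (Abelian.Ext (ModuleCat.of A (A ⧸ maximalIdeal A)) (ModuleCat.of A M) 1) = 1 := by
  obtain ⟨rs, hrs, hl, he⟩ := h.exists_isRegular_and_length_ext
  obtain ⟨r, rfl⟩ := length_eq_one_of_cast_eq_ringKrullDim hl
  exact he

open Pointwise in
theorem IsCanonicalModule.hasSimpleSocle {M : Type u} [AddCommGroup M] [Module A M]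
    (h : IsCanonicalModule A M) {a : A} (ha : IsParameter a) :
    HasSimpleSocle A (M ⧸ (a • ⊤ : Submodule A M)) :=
  (length_ext_one_eq_one_iff (h.isSMulRegular ha) ha.mem_maximalIdeal).mp h.length_ext_eq_one

theorem Ideal.isTypeOne_of_isCanonicalModule {J : Ideal A} (h : IsCanonicalModule A J) :
    J.IsTypeOne := fun _ hc hcm =>
  h.hasSimpleSocle (isParameter_of_mem_nonZeroDivisors hc hcm)

open Pointwise in
-- One parameter suffices, since `Ext¹(A / m, J)` detects the socle of `J / cJ` for every `c`.
theorem Ideal.isTypeOne_of_hasSimpleSocle {J : Ideal A} {a : A} (ha : IsParameter a)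
    (h : HasSimpleSocle A (J ⧸ (a • ⊤ : Submodule A J))) : J.IsTypeOne := by
  intro c hc hcm
  rw [← length_ext_one_eq_one_iff (isSMulRegular_ideal_of_mem_nonZeroDivisors hc J) hcm]
  exact (length_ext_one_eq_one_iff (isSMulRegular_ideal_of_mem_nonZeroDivisors
    ha.mem_nonZeroDivisors J) ha.mem_maximalIdeal).mpr h

theorem Ideal.IsTypeOne.isCanonicalModule {J : Ideal A} (hJ : J.IsTypeOne) {a : A}
    (ha : IsParameter a) (haJ : a ∈ J) : IsCanonicalModule A J where
  finite := inferInstance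
  exists_isRegular_and_length_ext := by
    have hreg := isSMulRegular_ideal_of_mem_nonZeroDivisors ha.mem_nonZeroDivisors J
    refine ⟨[a], ⟨?_, ?_⟩, ?_, ?_⟩
    · rw [RingTheory.Sequence.isWeaklyRegular_cons_iff]
      exact ⟨hreg, RingTheory.Sequence.IsWeaklyRegular.nil _ _⟩
    · intro h
      rw [Ideal.ofList_singleton] at h
      have hbot : (⊤ : Submodule A J) = ⊥ := by
        refine Submodule.eq_bot_of_le_smul_of_le_jacobson_bot (Ideal.span {a}) _
          Module.Finite.fg_top h.le ?_
        rw [Ideal.span_singleton_le_iff_mem, IsLocalRing.jacobson_eq_maximalIdeal _ bot_ne_top]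
        exact ha.mem_maximalIdeal
      have h0 : (⟨a, haJ⟩ : J) = 0 := (Submodule.mem_bot A).mp (hbot ▸ trivial)
      exact nonZeroDivisors.ne_zero ha.mem_nonZeroDivisors (congrArg Subtype.val h0)
    · rw [IsOneDimCMLocalRing.ringKrullDim_eq_one]
      rfl
    · exact (length_ext_one_eq_one_iff hreg ha.mem_maximalIdeal).mpr
        (hJ a ha.mem_nonZeroDivisors ha.mem_maximalIdeal)
  injectiveDimension_lt_top :=
    hJ.injectiveDimension_lt_top ha.mem_nonZeroDivisors ha.mem_maximalIdeal haJ

end CanonicalIdeal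

theorem IsLocalRing.map_mem_maximalIdeal {A B : Type*} [CommRing A] [CommRing B] [IsLocalRing A]
    [IsLocalRing B] (f : A →+* B) [IsLocalHom f] {x : A} (hx : x ∈ maximalIdeal A) :
    f x ∈ maximalIdeal B :=
  (mem_maximalIdeal _).mpr fun hu => (mem_maximalIdeal x).mp hx (isUnit_of_map_unit f x hu)

/-! ### Flat local base change of ideals, colengths and socles. -/

section FlatBaseChange

open Pointwise TensorProduct

variable {A : Type u} {B : Type v} [CommRing A] [CommRing B] [Algebra A B] [Module.Flat A B]

theorem algebraMap_mem_nonZeroDivisors_of_flat {b : A} (hb : b ∈ nonZeroDivisors A) :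
    algebraMap A B b ∈ nonZeroDivisors B := by
  rw [mem_nonZeroDivisors_iff_right]
  intro x hx
  refine (Module.Flat.isSMulRegular_of_nonZeroDivisors (M := B) hb) ?_
  simpa [Algebra.smul_def, mul_comm] using hx

/-- The extension of an ideal along a flat map is its base change. -/
theorem Ideal.exists_linearEquiv_tensor_map (J : Ideal A) :
    ∃ e : (B ⊗[A] J) ≃ₗ[B] J.map (algebraMap A B),
      ∀ (r : B) (j : J), (e (r ⊗ₜ j) : B) = r * algebraMap A B j := by
  let ε : (B ⊗[A] J) →ₗ[B] B :=
    (AlgebraTensorModule.rid A B B).toLinearMap ∘ₗ J.subtype.baseChange B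
  have hε : ∀ (r : B) (j : J), ε (r ⊗ₜ j) = r * algebraMap A B j := fun r j => by
    simp [ε, Algebra.smul_def, mul_comm]
  have hinj : Function.Injective ε := by
    refine (AlgebraTensorModule.rid A B B).injective.comp ?_
    rw [LinearMap.baseChange_eq_ltensor]
    exact Module.Flat.lTensor_preserves_injective_linearMap _ J.subtype_injective
  have hrange : LinearMap.range ε = J.map (algebraMap A B) := by
    apply le_antisymm
    · rintro _ ⟨t, rfl⟩
      induction t with
      | zero => simp
      | tmul r j =>
        rw [hε]
        exact Ideal.mul_mem_left _ _ (Ideal.mem_map_of_mem _ j.2)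
      | add x y hx hy =>
        rw [map_add]
        exact add_mem hx hy
    · rw [Ideal.map, Ideal.span, Submodule.span_le]
      rintro _ ⟨j, hj, rfl⟩
      exact ⟨1 ⊗ₜ ⟨j, hj⟩, by rw [hε, one_mul]⟩
  exact ⟨(LinearEquiv.ofInjective ε hinj).trans (LinearEquiv.ofEq _ _ hrange), hε⟩

theorem Ideal.nonempty_linearEquiv_tensor_quotient_smul_top (J : Ideal A) (a : A) :
    Nonempty ((B ⊗[A] (J ⧸ (a • ⊤ : Submodule A J))) ≃ₗ[B]
      (J.map (algebraMap A B) ⧸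
        (algebraMap A B a • ⊤ : Submodule B (J.map (algebraMap A B))))) := by
  obtain ⟨e, -⟩ := Ideal.exists_linearEquiv_tensor_map (B := B) J
  let q : (B ⊗[A] J) →ₗ[B] B ⊗[A] (J ⧸ (a • ⊤ : Submodule A J)) :=
    (Submodule.mkQ (a • ⊤ : Submodule A J)).baseChange B
  have hqs : Function.Surjective q := by
    simp only [q, LinearMap.baseChange_eq_ltensor]
    exact LinearMap.lTensor_surjective _ (Submodule.mkQ_surjective _)
  have hex : Function.Exact ((LinearMap.lsmul A J a).lTensor B) q := by
    simp only [q, LinearMap.baseChange_eq_ltensor]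
    exact lTensor_exact B (LinearMap.exact_lsmul_mkQ_smul_top J a) (Submodule.mkQ_surjective _)
  have hsm : ∀ t, (LinearMap.lsmul A J a).lTensor B t = algebraMap A B a • t := fun t => by
    induction t with
    | zero => simp
    | tmul r j =>
      rw [LinearMap.lTensor_tmul, LinearMap.lsmul_apply, TensorProduct.tmul_smul,
        algebraMap_smul]
    | add x y hx hy => rw [map_add, hx, hy, smul_add]
  have hker : LinearMap.ker (q ∘ₗ e.symm.toLinearMap) =
      (algebraMap A B a • ⊤ : Submodule B (J.map (algebraMap A B))) := by
    ext x
    rw [LinearMap.mem_ker, LinearMap.comp_apply, hex, Submodule.mem_smul_pointwise_iff_exists]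
    constructor
    · rintro ⟨t, ht⟩
      refine ⟨e t, trivial, ?_⟩
      rw [← map_smul, ← hsm, ht]
      exact e.apply_symm_apply x
    · rintro ⟨y, -, rfl⟩
      refine ⟨e.symm y, ?_⟩
      rw [hsm, ← map_smul]
      rfl
  exact ⟨((Submodule.quotEquivOfEq _ _ hker.symm).trans
    (LinearMap.quotKerEquivOfSurjective (q ∘ₗ e.symm.toLinearMap)
      (hqs.comp e.symm.surjective))).symm⟩

variable [IsLocalRing A] [IsLocalRing B] [IsLocalHom (algebraMap A B)]

theorem Ideal.colength_map_of_flat (P : Ideal A) :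
    (P.map (algebraMap A B)).colength =
      P.colength * ((maximalIdeal A).map (algebraMap A B)).colength := by
  rw [Ideal.colength, (Algebra.TensorProduct.quotIdealMapEquivTensorQuot B P).toLinearEquiv.length_eq]
  exact IsLocalRing.length_baseChange A B (A ⧸ P)

/-- The socle of `M` is a copy of `A / m`. Elements killed by the maximal ideal of `B` are killed by
`mB`, so by flatness they lie in `B ⊗ A / m = B / mB`, whose socle is simple by hypothesis. -/
theorem HasSimpleSocle.baseChange [IsNoetherianRing A] {M : Type*} [AddCommGroup M] [Module A M]
    (hM : HasSimpleSocle A M)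
    (hF : HasSimpleSocle B (B ⧸ (maximalIdeal A).map (algebraMap A B))) :
    HasSimpleSocle B (B ⊗[A] M) := by
  obtain ⟨s, hs0, hsm, hs⟩ := hM
  obtain ⟨G, hG⟩ := (maximalIdeal A).fg_of_isNoetherianRing
  let i : (A ⧸ maximalIdeal A) →ₗ[A] M :=
    (maximalIdeal A).liftQ (LinearMap.toSpanSingleton A M s) fun x hx => by simpa using hsm x hx
  have hi : ∀ r, i (Submodule.Quotient.mk r) = r • s := fun r => rfl
  have hinj : Function.Injective i := by
    rw [injective_iff_map_eq_zero]
    intro x hx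
    obtain ⟨x, rfl⟩ := Submodule.Quotient.mk_surjective _ x
    rw [hi] at hx
    rw [Submodule.Quotient.mk_eq_zero, mem_maximalIdeal]
    intro hu
    exact hs0 (hu.smul_eq_zero.mp hx)
  -- The socle as the kernel of multiplication by finitely many generators of `m`, so that flatness
  -- applies and the tensor product commutes with the power of `M`.
  let δ : M →ₗ[A] (G → M) := LinearMap.pi fun x => LinearMap.lsmul A M x
  have hex : Function.Exact i δ := by
    intro t
    constructor
    · intro ht
      obtain ⟨r, rfl⟩ := hs t fun x hx => by
        rw [← hG] at hx
        induction hx using Submodule.span_induction with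
        | mem x hx => exact congrFun ht ⟨x, hx⟩
        | zero => rw [zero_smul]
        | add x y _ _ hx hy => rw [add_smul, hx, hy, add_zero]
        | smul r x _ hx => rw [smul_assoc, hx, smul_zero]
      exact ⟨Submodule.Quotient.mk r, rfl⟩
    · rintro ⟨r, rfl⟩
      obtain ⟨r, rfl⟩ := Submodule.Quotient.mk_surjective _ r
      funext x
      change (x : A) • r • s = 0
      rw [smul_comm, hsm _ (hG ▸ Submodule.subset_span x.2), smul_zero]
  have hexB := Module.Flat.lTensor_exact B hex
  have hinjB := Module.Flat.lTensor_preserves_injective_linearMap (M := B) i hinj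
  rw [← LinearMap.baseChange_eq_ltensor] at hinjB
  obtain ⟨f, hf0, hfm, hf⟩ := hF.congr
    (Algebra.TensorProduct.quotIdealMapEquivTensorQuot B (maximalIdeal A)).toLinearEquiv
  refine ⟨i.baseChange B f, fun h => hf0 (hinjB (by rw [h, map_zero])),
    fun x hx => by rw [← map_smul, hfm x hx, map_zero], fun t ht => ?_⟩
  classical
  have hpi : ∀ (z : B ⊗[A] M) (x : G),
      TensorProduct.piRight A B B (fun _ : G => M) (δ.lTensor B z) x = algebraMap A B x • z := by
    intro z x
    induction z with
    | zero => simp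
    | tmul r m =>
      rw [LinearMap.lTensor_tmul, TensorProduct.piRight_apply, TensorProduct.piRightHom_tmul,
        algebraMap_smul, ← TensorProduct.tmul_smul]
      rfl
    | add u v hu hv => rw [map_add, map_add, Pi.add_apply, hu, hv, smul_add]
  have hδ : δ.lTensor B t = 0 := by
    apply (TensorProduct.piRight A B B (fun _ : G => M)).injective
    funext x
    rw [hpi, map_zero]
    refine ht _ ?_
    have : (x : A) ∈ maximalIdeal A := hG ▸ Submodule.subset_span x.2
    exact map_mem_maximalIdeal _ this
  obtain ⟨w, hw⟩ := (hexB t).mp hδ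
  have hw' : i.baseChange B w = t := by
    rw [LinearMap.baseChange_eq_ltensor]
    exact hw
  obtain ⟨r, rfl⟩ := hf w fun x hx => hinjB (by rw [map_smul, hw', ht x hx, map_zero])
  exact ⟨r, by rw [← hw', map_smul]⟩

theorem isParameter_algebraMap {A : Type u} {B : Type v} [CommRing A] [CommRing B] [Algebra A B]
    [Module.Flat A B] [IsOneDimCMLocalRing A] [IsOneDimCMLocalRing B]
    [IsLocalHom (algebraMap A B)] {a : A} (ha : IsParameter a) :
    IsParameter (algebraMap A B a) :=
  isParameter_of_mem_nonZeroDivisors (algebraMap_mem_nonZeroDivisors_of_flat ha.mem_nonZeroDivisors)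
    (map_mem_maximalIdeal _ ha.mem_maximalIdeal)

end FlatBaseChange

/-! ### Base change of canonical ideals and of Sally lengths. -/

section CanonicalBaseChange

variable {A : Type u} {B : Type v} [CommRing A] [CommRing B] [Algebra A B] [Module.Flat A B]
  [IsOneDimCMLocalRing A] [IsOneDimCMLocalRing B] [IsLocalHom (algebraMap A B)]

/-- The fiber is Artinian because `mB` contains the image of a parameter, so finite self-injective
dimension gives a simple socle over the fiber ring, which is the same as over `B`. -/
theorem hasSimpleSocle_fiber
    (hF : IsGorensteinLocalRing (B ⧸ (maximalIdeal A).map (algebraMap A B))) :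
    HasSimpleSocle B (B ⧸ (maximalIdeal A).map (algebraMap A B)) := by
  obtain ⟨a, ha⟩ := exists_isParameter (A := A)
  have hfin : IsFiniteLength B (B ⧸ (maximalIdeal A).map (algebraMap A B)) :=
    Ideal.isFiniteLength_quotient (isParameter_algebraMap (B := B) ha).mem_nonZeroDivisors
      (Ideal.mem_map_of_mem _ ha.mem_maximalIdeal)
  have := (isFiniteLength_iff_isNoetherian_isArtinian.mp hfin).2
  have hart : IsArtinianRing (B ⧸ (maximalIdeal A).map (algebraMap A B)) :=
    isArtinian_of_tower B this
  have := hF.isLocalRing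
  obtain ⟨s, hs0, hsm, hs⟩ := hF.hasSimpleSocle
  have hloc := IsLocalHom.of_surjective
    (Ideal.Quotient.mk ((maximalIdeal A).map (algebraMap A B))) Ideal.Quotient.mk_surjective
  refine ⟨s, hs0, fun x hx => ?_, fun t ht => ?_⟩
  · have := hsm (Ideal.Quotient.mk _ x) (map_mem_maximalIdeal _ hx)
    rwa [Algebra.smul_def]
  · obtain ⟨r, hr⟩ := hs t fun x hx => by
      obtain ⟨x, rfl⟩ := Ideal.Quotient.mk_surjective x
      have := ht x (by
        rw [mem_maximalIdeal] at hx ⊢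
        exact fun hu => hx (hu.map _))
      rwa [Algebra.smul_def] at this
    obtain ⟨r, rfl⟩ := Ideal.Quotient.mk_surjective r
    exact ⟨r, by rw [hr, Algebra.smul_def]; rfl⟩

theorem Ideal.IsTypeOne.map (hF : IsGorensteinLocalRing (B ⧸ (maximalIdeal A).map (algebraMap A B)))
    {J : Ideal A} (hJ : J.IsTypeOne) : (J.map (algebraMap A B)).IsTypeOne := by
  obtain ⟨a, ha⟩ := exists_isParameter (A := A)
  obtain ⟨e⟩ := Ideal.nonempty_linearEquiv_tensor_quotient_smul_top (B := B) J a
  exact Ideal.isTypeOne_of_hasSimpleSocle (isParameter_algebraMap ha)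
    (((hJ a ha.mem_nonZeroDivisors ha.mem_maximalIdeal).baseChange (hasSimpleSocle_fiber hF)).congr e)

/-- Every colength in `sallyLength_add_colength` is multiplied by the length of `B / mB`; the finite
colength of the power cancels. -/
theorem sallyLength_map {I : Ideal A} {a : A} (ha : IsParameter a) (haI : a ∈ I) (n : ℕ) :
    sallyLength (I.map (algebraMap A B)) (algebraMap A B a) n =
      sallyLength I a n * ((maximalIdeal A).map (algebraMap A B)).colength := by
  have haB := (isParameter_algebraMap (B := B) ha).mem_nonZeroDivisors
  have haIB : algebraMap A B a ∈ I.map (algebraMap A B) := Ideal.mem_map_of_mem _ haI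
  have h1 := sallyLength_add_colength ha.mem_nonZeroDivisors haI n
  have h2 := sallyLength_add_colength haB haIB n
  have h3 : (Ideal.span {algebraMap A B a}) = (Ideal.span {a}).map (algebraMap A B) := by
    rw [Ideal.map_span, Set.image_singleton]
  have hfin := Ideal.colength_ne_top (pow_mem haB (n + 1)) (Ideal.pow_mem_pow haIB (n + 1))
  refine ENat.add_left_injective_of_ne_top hfin ?_
  change _ + _ = _ + _
  rw [h2, h3, ← Ideal.map_pow, Ideal.colength_map_of_flat I,
    Ideal.colength_map_of_flat (Ideal.span {a}), Ideal.colength_map_of_flat (I ^ (n + 1)),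
    ← add_mul, h1]
  ring

end CanonicalBaseChange

/-! ### The rank of the Sally module is the length of a graded piece. -/

theorem isLocalizedModule_mkLinearMap_comp {T M N : Type*} [CommRing T] [AddCommGroup M]
    [Module T M] [AddCommGroup N] [Module T N] (S : Submonoid T) {f : M →ₗ[T] N}
    (hf : Function.Injective f) (hs : ∀ y : N, ∃ s ∈ S, s • y ∈ LinearMap.range f) :
    IsLocalizedModule S (LocalizedModule.mkLinearMap S N ∘ₗ f) where
  map_units := IsLocalizedModule.map_units (LocalizedModule.mkLinearMap S N)
  surj y := by
    obtain ⟨⟨s, c⟩, hc⟩ := IsLocalizedModule.surj S (LocalizedModule.mkLinearMap S N) y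
    obtain ⟨d, hd, x, hx⟩ := hs s
    refine ⟨(x, ⟨d, hd⟩ * c), ?_⟩
    rw [LinearMap.comp_apply, hx, map_smul, ← hc, mul_smul]
    rfl
  exists_of_eq {x y} hxy := by
    obtain ⟨c, hc⟩ := IsLocalizedModule.exists_of_eq (S := S)
      (f := LocalizedModule.mkLinearMap S N) hxy
    refine ⟨c, hf ?_⟩
    rw [Submonoid.smul_def, Submonoid.smul_def, map_smul, map_smul]
    exact hc

/-- The map `T ⊗ V → N` becomes an isomorphism at `p`, so the localization of `N` is `T_p ⊗ V`.
Length is preserved because `A → T_p` is flat and local with `mT_p` maximal. -/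
theorem length_localizedModule_eq_of_liftBaseChange {A T V N : Type*} [CommRing A]
    [IsLocalRing A] [CommRing T] [Algebra A T] [Module.Flat A T] [AddCommGroup V] [Module A V]
    [AddCommGroup N] [Module A N] [Module T N] [IsScalarTower A T N] {p : Ideal T} [p.IsPrime]
    (hp : (maximalIdeal A).map (algebraMap A T) = p) {f : V →ₗ[A] N}
    (hf : Function.Injective (f.liftBaseChange T))
    (hs : ∀ y : N, ∃ s ∈ p.primeCompl, s • y ∈ LinearMap.range (f.liftBaseChange T)) :
    Module.length (Localization.AtPrime p) (LocalizedModule p.primeCompl N) =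
      Module.length A V := by
  have := isLocalizedModule_mkLinearMap_comp p.primeCompl hf hs
  have h1 := (IsLocalizedModule.isBaseChange p.primeCompl (Localization.AtPrime p)
    (LocalizedModule.mkLinearMap p.primeCompl N ∘ₗ f.liftBaseChange T)).equiv
  have h2 := (TensorProduct.AlgebraTensorModule.cancelBaseChange A T
    (Localization.AtPrime p) (Localization.AtPrime p) V).symm.trans h1
  have : Module.Flat A (Localization.AtPrime p) := Module.Flat.trans A T _
  have hmap : (maximalIdeal A).map (algebraMap A (Localization.AtPrime p)) =
      maximalIdeal (Localization.AtPrime p) := by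
    rw [IsScalarTower.algebraMap_eq A T, ← Ideal.map_map, hp]
    exact Localization.AtPrime.map_eq_maximalIdeal
  have : IsLocalHom (algebraMap A (Localization.AtPrime p)) :=
    ((IsLocalRing.local_hom_TFAE _).out 0 2).mpr hmap.le
  have h3 := IsLocalRing.length_baseChange A (Localization.AtPrime p) V
  have : IsSimpleModule (Localization.AtPrime p)
      (Localization.AtPrime p ⧸ maximalIdeal (Localization.AtPrime p)) :=
    isSimpleModule_iff_isCoatom.mpr (maximalIdeal.isMaximal _).out
  rwa [h2.length_eq, hmap, Module.length_eq_one (Localization.AtPrime p) (_ ⧸ _), mul_one] at h3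

section SallyRank

open TensorProduct

variable {A : Type u} [CommRing A]

theorem coeff_mem_pow_of_mem_reesNumerator {I : Ideal A} {a : A} (haI : a ∈ I) {h : A[X]}
    (hh : h ∈ reesNumerator I a) (j : ℕ) : h.coeff j ∈ I ^ (j + 1) := by
  induction hh using Submodule.span_induction generalizing j with
  | mem h hh =>
    obtain ⟨x, hx, f, hf, rfl⟩ := hh
    rw [coeff_C_mul, pow_succ']
    exact Ideal.mul_mem_mul hx (hf j)
  | zero => simp
  | add f g _ _ hf hg =>
    rw [coeff_add]
    exact add_mem (hf j) (hg j)
  | smul t f _ hf =>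
    change ((t : A[X]) * f).coeff j ∈ _
    rw [coeff_mul]
    refine sum_mem fun ij hij => ?_
    rw [← Finset.HasAntidiagonal.mem_antidiagonal.mp hij, add_assoc, pow_add]
    exact Ideal.mul_mem_mul (Ideal.pow_right_mono
      ((Ideal.span_singleton_le_iff_mem _).mpr haI) _ (t.2 ij.1)) (hf ij.2)

theorem monomial_mem_reesNumerator {I : Ideal A} (a : A) {j : ℕ} {x : A} (hx : x ∈ I ^ (j + 1)) :
    monomial j x ∈ reesNumerator I a := by
  rw [pow_succ'] at hx
  induction hx using Submodule.mul_induction_on' with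
  | mem_mul_mem y hy z hz =>
    refine Submodule.subset_span ⟨y, hy, monomial j z, reesAlgebra.monomial_mem.mpr hz, ?_⟩
    rw [C_mul_monomial]
  | add y _ z _ hy hz =>
    rw [map_add]
    exact add_mem hy hz

theorem coeff_mem_of_mem_reesDenominator {I : Ideal A} {a : A} {h : A[X]}
    (hh : h ∈ reesDenominator I a) (j : ℕ) : h.coeff j ∈ Ideal.span {a ^ j} * I := by
  induction hh using Submodule.span_induction generalizing j with
  | mem h hh =>
    obtain ⟨x, hx, rfl⟩ := hh
    rw [coeff_C]
    split_ifs with hj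
    · simpa [hj] using hx
    · exact zero_mem _
  | zero => simp
  | add f g _ _ hf hg =>
    rw [coeff_add]
    exact add_mem (hf j) (hg j)
  | smul t f _ hf =>
    change ((t : A[X]) * f).coeff j ∈ _
    rw [coeff_mul]
    refine sum_mem fun ij hij => ?_
    rw [← Finset.HasAntidiagonal.mem_antidiagonal.mp hij, pow_add, ← Ideal.span_singleton_mul_span_singleton,
      mul_assoc]
    refine Ideal.mul_mem_mul ?_ (hf ij.2)
    rw [← Ideal.span_singleton_pow]
    exact t.2 ij.1

/-- The element `(at) ^ i` of the Rees algebra `A[at]`. -/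
noncomputable def reesMonomial (a : A) (i : ℕ) : reesAlgebra (Ideal.span {a}) :=
  ⟨monomial i (a ^ i), reesAlgebra.monomial_mem.mpr
    (Ideal.pow_mem_pow (Ideal.mem_span_singleton_self a) i)⟩

theorem reesMonomial_smul_monomial (a : A) (i j : ℕ) (x : A) :
    reesMonomial a i • monomial j x = monomial (i + j) (a ^ i * x) :=
  monomial_mul_monomial i j _ x

theorem reesMonomial_pow (a : A) (i : ℕ) : reesMonomial a 1 ^ i = reesMonomial a i := by
  refine Subtype.ext ?_
  change (monomial 1 (a ^ 1)) ^ i = monomial i (a ^ i)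
  rw [monomial_pow, pow_one, one_mul]

theorem monomial_mem_reesDenominator {I : Ideal A} {a : A} {j : ℕ} {x : A}
    (hx : x ∈ Ideal.span {a ^ j} * I) : monomial j x ∈ reesDenominator I a := by
  obtain ⟨z, hz, rfl⟩ := Ideal.mem_span_singleton_mul.mp hx
  have := (reesDenominator I a).smul_mem (reesMonomial a j)
    (Submodule.subset_span ⟨z, hz, rfl⟩ : C z ∈ reesDenominator I a)
  rwa [← monomial_zero_left, reesMonomial_smul_monomial, add_zero] at this

/-- The powers of `at` form a basis of the Rees algebra `A[at]`, for `a` a nonzerodivisor. -/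
noncomputable def reesBasis {a : A} (ha : a ∈ nonZeroDivisors A) :
    Module.Basis ℕ A (reesAlgebra (Ideal.span {a})) :=
  Module.Basis.mk (v := reesMonomial a)
    (by
      rw [linearIndependent_iff']
      intro s g hg i hi
      have h1 := congrArg (fun t : reesAlgebra (Ideal.span {a}) => (t : A[X]).coeff i) hg
      simp only [AddSubmonoidClass.coe_finsetSum, finsetSum_coeff] at h1
      have h2 : ∀ k, ((g k • reesMonomial a k : reesAlgebra (Ideal.span {a})) : A[X]).coeff i =
          if k = i then g k * a ^ k else 0 := fun k => by
        change (g k • monomial k (a ^ k)).coeff i = _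
        rw [coeff_smul, coeff_monomial]
        split_ifs <;> simp
      simp only [h2, Finset.sum_ite_eq', hi, if_true] at h1
      exact (mul_right_mem_nonZeroDivisors_eq_zero_iff (pow_mem ha i)).mp (by simpa using h1))
    (by
      intro g _
      have hg : ∀ n, ∃ r : A, r * a ^ n = (g : A[X]).coeff n := fun n => by
        have := g.2 n
        rwa [Ideal.span_singleton_pow, Ideal.mem_span_singleton'] at this
      choose r hr using hg
      have : g = ∑ n ∈ (g : A[X]).support, r n • reesMonomial a n := by
        refine Subtype.ext ?_
        rw [AddSubmonoidClass.coe_finsetSum]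
        conv_lhs => rw [(g : A[X]).as_sum_support]
        refine Finset.sum_congr rfl fun n _ => ?_
        change _ = r n • monomial n (a ^ n)
        rw [smul_monomial, smul_eq_mul, hr]
      rw [this]
      exact sum_mem fun n _ => Submodule.smul_mem _ _ (Submodule.subset_span ⟨n, rfl⟩))

@[simp]
theorem reesBasis_apply {a : A} (ha : a ∈ nonZeroDivisors A) (i : ℕ) :
    reesBasis ha i = reesMonomial a i :=
  Module.Basis.mk_apply _ _ i

/-- The map from the graded piece `I ^ (n + 1) / a ^ n I` to the Sally module. -/
noncomputable def sallyPiece (I : Ideal A) (a : A) (n : ℕ) :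
    (↥(I ^ (n + 1)) ⧸ (Ideal.span {a ^ n} * I).submoduleOf (I ^ (n + 1))) →ₗ[A]
      SallyModule I a :=
  Submodule.liftQ _
    { toFun := fun x => Submodule.Quotient.mk
        ⟨monomial n (x : A), monomial_mem_reesNumerator a x.2⟩
      map_add' := fun x y => by
        rw [← Submodule.Quotient.mk_add]
        exact congrArg _ (Subtype.ext (map_add _ _ _))
      map_smul' := fun r x => by
        rw [← Submodule.Quotient.mk_smul]
        exact congrArg _ (Subtype.ext (map_smul (monomial n) r (x : A))) }
    fun _ hx => (Submodule.Quotient.mk_eq_zero _).mpr (monomial_mem_reesDenominator hx)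

theorem sallyPiece_mk (I : Ideal A) (a : A) (n : ℕ) (x : ↥(I ^ (n + 1))) :
    sallyPiece I a n (Submodule.Quotient.mk x) =
      Submodule.Quotient.mk ⟨monomial n (x : A), monomial_mem_reesNumerator a x.2⟩ := rfl

/-- The map `A[at] ⊗ I ^ (n + 1) / a ^ n I → S` into the Sally module. -/
noncomputable def sallyPieceLift (I : Ideal A) (a : A) (n : ℕ) :
    reesAlgebra (Ideal.span {a}) ⊗[A]
      (↥(I ^ (n + 1)) ⧸ (Ideal.span {a ^ n} * I).submoduleOf (I ^ (n + 1)))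
      →ₗ[reesAlgebra (Ideal.span {a})] SallyModule I a :=
  (sallyPiece I a n).liftBaseChange _

theorem sallyPieceLift_tmul_mk (I : Ideal A) (a : A) (n i : ℕ) (x : ↥(I ^ (n + 1))) :
    sallyPieceLift I a n (reesMonomial a i ⊗ₜ Submodule.Quotient.mk x) =
      Submodule.Quotient.mk (reesMonomial a i •
        (⟨monomial n (x : A), monomial_mem_reesNumerator a x.2⟩ : reesNumerator I a)) := by
  rw [sallyPieceLift, LinearMap.liftBaseChange_tmul, sallyPiece_mk, Submodule.Quotient.mk_smul]

/-- Expand in the basis `(at) ^ i`. In degree `i + n` the coefficient is `a ^ i x_i`, and it lies in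
`a ^ (i + n) I` only if `x_i ∈ a ^ n I`. -/
theorem sallyPieceLift_injective {I : Ideal A} {a : A} (ha : a ∈ nonZeroDivisors A) (n : ℕ) :
    Function.Injective (sallyPieceLift I a n) := by
  rw [injective_iff_map_eq_zero]
  intro z hz
  obtain ⟨c, rfl⟩ := TensorProduct.eq_repr_basis_left (reesBasis ha) z
  choose x hx using fun i => Submodule.Quotient.mk_surjective _ (c i)
  have hc : c = 0 := by
    ext i
    by_cases hi : i ∈ c.support
    swap
    · simpa using hi
    rw [Finsupp.sum, map_sum] at hz
    have h1 : ∀ k, sallyPieceLift I a n (reesBasis ha k ⊗ₜ c k) = Submodule.Quotient.mk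
        (reesMonomial a k •
        (⟨monomial n (x k : A), monomial_mem_reesNumerator a (x k).2⟩ : reesNumerator I a)) :=
      fun k => by rw [reesBasis_apply, ← hx, sallyPieceLift_tmul_mk]
    simp only [h1] at hz
    simp only [← Submodule.mkQ_apply] at hz
    rw [← map_sum, Submodule.mkQ_apply, Submodule.Quotient.mk_eq_zero] at hz
    have h2 := coeff_mem_of_mem_reesDenominator hz (i + n)
    rw [Submodule.subtype_apply, AddSubmonoidClass.coe_finsetSum, finsetSum_coeff] at h2
    have h3 : ∀ k, ((reesMonomial a k • (⟨monomial n (x k : A),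
        monomial_mem_reesNumerator a (x k).2⟩ : reesNumerator I a) : reesNumerator I a) :
        A[X]).coeff (i + n) = if k = i then a ^ k * x k else 0 := fun k => by
      change (reesMonomial a k • monomial n (x k : A)).coeff (i + n) = _
      rw [reesMonomial_smul_monomial, coeff_monomial]
      simp
    simp only [h3, Finset.sum_ite_eq', hi, if_true] at h2
    rw [pow_add, ← Ideal.span_singleton_mul_span_singleton, mul_assoc] at h2
    obtain ⟨z, hz, hz'⟩ := Ideal.mem_span_singleton_mul.mp h2
    rw [← hx, Finsupp.coe_zero, Pi.zero_apply, Submodule.Quotient.mk_eq_zero]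
    change (x i : A) ∈ Ideal.span {a ^ n} * I
    have h4 : z = x i := (mul_cancel_left_mem_nonZeroDivisors (pow_mem ha i)).mp hz'
    exact h4 ▸ hz
  rw [hc, Finsupp.sum_zero_index]

/-- In degree `j`, the product with `a ^ n` lies in `I ^ (n + j + 1) = a ^ j I ^ (n + 1)`, thus
comes from `(at) ^ j` times the piece of degree `n`. -/
theorem reesMonomial_smul_mem_range {I : Ideal A} {a : A} (haI : a ∈ I) {n : ℕ}
    (hI : I ^ (n + 1) = Ideal.span {a} * I ^ n) (s : SallyModule I a) :
    reesMonomial a n • s ∈ LinearMap.range (sallyPieceLift I a n) := by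
  obtain ⟨⟨f, hf⟩, rfl⟩ := Submodule.Quotient.mk_surjective _ s
  have hfj := coeff_mem_pow_of_mem_reesNumerator haI hf
  have hsum : (⟨f, hf⟩ : reesNumerator I a) = ∑ j ∈ f.support,
      ⟨monomial j (f.coeff j), monomial_mem_reesNumerator a (hfj j)⟩ := by
    refine Subtype.ext ?_
    rw [AddSubmonoidClass.coe_finsetSum]
    exact f.as_sum_support
  rw [hsum, ← Submodule.mkQ_apply, map_sum, Finset.smul_sum]
  refine sum_mem fun j _ => ?_
  have h1 : a ^ n * f.coeff j ∈ Ideal.span {a ^ j} * I ^ (n + 1) := by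
    have h2 : ∀ j, I ^ (n + j) = Ideal.span {a ^ j} * I ^ n := fun j => by
      induction j with
      | zero => simp
      | succ j ih =>
        rw [← add_assoc, pow_succ, ih, mul_assoc, ← pow_succ, hI, ← mul_assoc,
          Ideal.span_singleton_mul_span_singleton, ← pow_succ]
    have h3 : I ^ n * I ^ (j + 1) = Ideal.span {a ^ j} * I ^ (n + 1) := by
      rw [← pow_add, ← add_assoc, pow_succ, h2, mul_assoc, ← pow_succ]
    rw [← h3]
    exact Ideal.mul_mem_mul (Ideal.pow_mem_pow haI n) (hfj j)
  obtain ⟨z, hz, hz'⟩ := Ideal.mem_span_singleton_mul.mp h1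
  refine ⟨reesMonomial a j ⊗ₜ Submodule.Quotient.mk ⟨z, hz⟩, ?_⟩
  rw [sallyPieceLift_tmul_mk, Submodule.mkQ_apply, ← Submodule.Quotient.mk_smul]
  congr 1
  refine Subtype.ext ?_
  change reesMonomial a j • monomial n z = reesMonomial a n • monomial j (f.coeff j)
  rw [reesMonomial_smul_monomial, reesMonomial_smul_monomial, hz', add_comm]

variable [IsLocalRing A]

theorem coeff_mem_of_mem_sallyPrime {a : A} {t : reesAlgebra (Ideal.span {a})}
    (ht : t ∈ sallyPrime a) (j : ℕ) : (t : A[X]).coeff j ∈ maximalIdeal A * Ideal.span {a} ^ j := by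
  induction ht using Submodule.span_induction generalizing j with
  | mem t ht =>
    obtain ⟨x, hx, rfl⟩ := ht
    change (C x).coeff j ∈ _
    rw [coeff_C]
    split_ifs with hj
    · simpa [hj] using hx
    · exact zero_mem _
  | zero => simp
  | add f g _ _ hf hg =>
    change ((f : A[X]) + (g : A[X])).coeff j ∈ _
    rw [coeff_add]
    exact add_mem (hf j) (hg j)
  | smul t f _ hf =>
    change ((t : A[X]) * (f : A[X])).coeff j ∈ _
    rw [coeff_mul]
    refine sum_mem fun ij hij => ?_
    rw [← Finset.HasAntidiagonal.mem_antidiagonal.mp hij, pow_add, mul_left_comm]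
    exact Ideal.mul_mem_mul (t.2 ij.1) (hf ij.2)

/-- Otherwise `a ∈ ma`, that is, `a (1 - z) = 0` with `1 - z` a unit. -/
theorem reesMonomial_one_notMem_sallyPrime {a : A} (ha : a ≠ 0) :
    reesMonomial a 1 ∉ sallyPrime a := by
  intro h
  have h1 := coeff_mem_of_mem_sallyPrime h 1
  change (monomial 1 (a ^ 1)).coeff 1 ∈ _ at h1
  rw [coeff_monomial_same, pow_one, pow_one, mul_comm, Ideal.mem_span_singleton_mul] at h1
  obtain ⟨z, hz, hz'⟩ := h1
  have hu : IsUnit (1 - z) := by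
    by_contra hu
    exact (Ideal.ne_top_iff_one _).mp (maximalIdeal.isMaximal A).ne_top
      (by simpa using add_mem ((mem_maximalIdeal _).mpr hu) hz)
  exact ha (hu.mul_left_eq_zero.mp (by rw [mul_sub, mul_one, hz', sub_self]))

end SallyRank

theorem sallyRank_eq_sallyLength {A : Type u} [CommRing A] [IsOneDimCMLocalRing A] {I : Ideal A}
    {a : A} (ha : IsParameter a) (haI : a ∈ I) {n : ℕ}
    (hI : I ^ (n + 1) = Ideal.span {a} * I ^ n) : sallyRank I a ha = sallyLength I a n := by
  have hnzd := ha.mem_nonZeroDivisors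
  have hp : (sallyPrime a).IsPrime := sallyPrime_isPrime ha.not_isNilpotent
  have : Module.Free A (reesAlgebra (Ideal.span {a})) := .of_basis (reesBasis hnzd)
  refine length_localizedModule_eq_of_liftBaseChange rfl (f := sallyPiece I a n)
    (sallyPieceLift_injective hnzd n) fun y =>
    ⟨reesMonomial a n, ?_, reesMonomial_smul_mem_range haI hI y⟩
  rw [← reesMonomial_pow]
  exact Submonoid.pow_mem (sallyPrime a).primeCompl
    (reesMonomial_one_notMem_sallyPrime (nonZeroDivisors.ne_zero hnzd)) n

/-! ### Sally length two, Sally length one, and the almost Gorenstein property. -/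

section AlmostGorenstein

variable {A : Type u} [CommRing A] [IsOneDimCMLocalRing A] {I : Ideal A} {a : A} {n : ℕ}

/-- Independence of the rank from `I` and `a`: two canonical ideals are proportional, and both
lengths can be compared at a common exponent beyond both reduction numbers. -/
theorem isTwoAGL_iff_sallyLength_eq_two (hI : IsCanonicalIdeal I) (ha : IsParameter a)
    (haI : a ∈ I) (h : I ^ (n + 1) = Ideal.span {a} * I ^ n) :
    IsTwoAGL A ↔ sallyLength I a n = 2 := by
  constructor
  · rintro ⟨I', a', ha', hI', ⟨hle, n', h'⟩, hr⟩
    have haI' : a' ∈ I' := (Ideal.span_singleton_le_iff_mem _).mp hle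
    have hm := Ideal.pow_succ_eq_span_singleton_mul_of_le h (le_max_left n n')
    have hm' := Ideal.pow_succ_eq_span_singleton_mul_of_le h' (le_max_right n n')
    obtain ⟨y, hy, hyI⟩ := (Ideal.isTypeOne_of_isCanonicalModule hI.isCanonicalModule).exists_mul_eq_mul
      (Ideal.isTypeOne_of_isCanonicalModule hI'.isCanonicalModule) ha.mem_nonZeroDivisors haI
      ha'.mem_nonZeroDivisors haI'
    rw [← sallyRank_eq_sallyLength ha haI h, sallyRank_eq_sallyLength ha haI hm,
      sallyLength_eq_of_span_singleton_mul_eq ha.mem_nonZeroDivisors haI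
        ha'.mem_nonZeroDivisors haI' hy ha.mem_nonZeroDivisors
        (Ideal.pow_succ_eq_span_singleton_mul_of_le hm (Nat.le_succ _))
        (Ideal.pow_succ_eq_span_singleton_mul_of_le hm' (Nat.le_succ _)) hyI,
      ← sallyRank_eq_sallyLength ha' haI' hm', hr]
  · intro h2
    exact ⟨I, a, ha, hI, ⟨(Ideal.span_singleton_le_iff_mem _).mpr haI, n, h⟩,
      (sallyRank_eq_sallyLength ha haI h).trans h2⟩

/-- View `A ⊆ K` with `mK ⊆ A`. For a parameter `b`, the ideal `J = bK ⊆ A` is isomorphic to `K`,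
contains `b`, and satisfies `mJ = b(mK) ⊆ (b)`. -/
theorem IsAGL.exists_ideal (h : IsAGL A) : ∃ (J : Ideal A) (b : A), IsParameter b ∧ b ∈ J ∧
    J.IsTypeOne ∧ maximalIdeal A * J ≤ Ideal.span {b} := by
  obtain ⟨K, _, _, C, _, _, f, g, hK, hf, hfg, -, hC⟩ := h
  obtain ⟨b, hb⟩ := exists_isParameter (A := A)
  have hr : ∀ r ∈ maximalIdeal A, ∀ x : K, ∃ t, f t = r • x := fun r hr x =>
    (hfg (r • x)).mp (by
      rw [map_smul, ← Submodule.mem_bot A, ← hC]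
      exact Submodule.smul_mem_smul hr trivial)
  let W : Submodule A K := LinearMap.range (LinearMap.lsmul A K b)
  let f' : W.comap f →ₗ[A] W := f.restrict fun _ hx => hx
  have hf' : Function.Bijective f' := by
    refine ⟨fun x y hxy => Subtype.ext (hf (congrArg Subtype.val hxy)), ?_⟩
    rintro ⟨_, x, rfl⟩
    obtain ⟨t, ht⟩ := hr b hb.mem_maximalIdeal x
    exact ⟨⟨t, x, ht.symm⟩, Subtype.ext ht⟩
  let e : K ≃ₗ[A] W.comap f :=
    (LinearEquiv.ofInjective (LinearMap.lsmul A K b) (hK.isSMulRegular hb)).trans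
      (LinearEquiv.ofBijective f' hf').symm
  refine ⟨W.comap f, b, hb, ⟨f 1, ?_⟩, Ideal.isTypeOne_of_hasSimpleSocle hb
    ((hK.hasSimpleSocle hb).congr (Submodule.Quotient.equiv _ _ e ?_)), ?_⟩
  · rw [LinearMap.lsmul_apply, ← map_smul, smul_eq_mul, mul_one]
  · rw [Submodule.map_pointwise_smul, Submodule.map_top, LinearEquiv.range]
  · rw [Ideal.mul_le]
    rintro r hrm s ⟨x, hx⟩
    obtain ⟨t, ht⟩ := hr r hrm x
    refine Ideal.mem_span_singleton'.mpr ⟨t, hf ?_⟩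
    rw [LinearMap.lsmul_apply] at hx
    rw [mul_comm t, ← smul_eq_mul, ← smul_eq_mul, map_smul, map_smul, ht, ← hx, smul_comm]

/-- The relation `mJ ⊆ (b)` is transported along `yJ = bI` to `mI ⊆ (y)` with `y ∈ I`. Here `(y)`
need not be the chosen reduction of `I`, hence the general `i` in
`sallyLength_eq_zero_or_maximalIdeal_mul_le`. -/
theorem IsAGL.sallyLength_le_one (hA : IsAGL A) (hI : I.IsTypeOne) (ha : IsParameter a)
    (haI : a ∈ I) (h : I ^ (n + 1 + 1) = Ideal.span {a} * I ^ (n + 1)) :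
    sallyLength I a n ≤ 1 := by
  obtain ⟨J, b, hb, hbJ, hJ, hm⟩ := hA.exists_ideal
  obtain ⟨y, hy, hyJ⟩ := hJ.exists_mul_eq_mul hI hb.mem_nonZeroDivisors hbJ
    ha.mem_nonZeroDivisors haI
  have hyI : y ∈ I := by
    have h1 : b * y ∈ Ideal.span {b} * I := by
      rw [← hyJ, mul_comm b]
      exact Ideal.mul_mem_mul (Ideal.mem_span_singleton_self y) hbJ
    obtain ⟨z, hz, hz'⟩ := Ideal.mem_span_singleton_mul.mp h1
    rwa [← (mul_cancel_left_mem_nonZeroDivisors hb.mem_nonZeroDivisors).mp hz']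
  have hmI : maximalIdeal A * I ≤ Ideal.span {y} := by
    refine Ideal.span_singleton_mul_right_inj_of_mem_nonZeroDivisors hb.mem_nonZeroDivisors ?_
    rw [mul_left_comm, ← hyJ, mul_left_comm, mul_comm (Ideal.span {b})]
    exact Ideal.mul_mono_right hm
  rcases sallyLength_eq_zero_or_maximalIdeal_mul_le ha.mem_nonZeroDivisors haI h hy hyI hmI with
    h0 | h1
  · rw [h0]
    exact zero_le
  · exact _root_.sallyLength_le_one ha.mem_nonZeroDivisors ha.mem_maximalIdeal haI hI h1

theorem isAGL_of_maximalIdeal_mul_le (hI : IsCanonicalModule A I) (ha : a ∈ nonZeroDivisors A)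
    (haI : a ∈ I) (hm : maximalIdeal A * I ≤ Ideal.span {a}) : IsAGL A := by
  let f : A →ₗ[A] I := LinearMap.toSpanSingleton A I ⟨a, haI⟩
  refine ⟨I, inferInstance, inferInstance, I ⧸ LinearMap.range f, inferInstance, inferInstance, f,
    (LinearMap.range f).mkQ, hI, ?_, ?_, Submodule.mkQ_surjective _, ?_⟩
  · rw [injective_iff_map_eq_zero]
    intro r hr
    exact (mul_right_mem_nonZeroDivisors_eq_zero_iff ha).mp (congrArg Subtype.val hr)
  · rw [LinearMap.exact_iff, Submodule.ker_mkQ]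
  · rw [eq_bot_iff, Submodule.smul_le]
    intro r hr c _
    obtain ⟨x, rfl⟩ := Submodule.mkQ_surjective _ c
    rw [← map_smul, Submodule.mem_bot, Submodule.mkQ_apply, Submodule.Quotient.mk_eq_zero]
    obtain ⟨t, ht⟩ := Ideal.mem_span_singleton'.mp (hm (Ideal.mul_mem_mul hr x.2))
    exact ⟨t, Subtype.ext ht⟩

theorem isGorensteinLocalRing_of_eq_span_singleton (hI : IsCanonicalModule A I)
    (ha : a ∈ nonZeroDivisors A) (h : I = Ideal.span {a}) : IsGorensteinLocalRing A where
  isLocalRing := inferInstance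
  isNoetherianRing := inferInstance
  injectiveDimension_lt_top := by
    have hinj : Function.Injective (LinearMap.toSpanSingleton A A a) := by
      rw [injective_iff_map_eq_zero]
      exact fun r hr => (mul_right_mem_nonZeroDivisors_eq_zero_iff ha).mp hr
    have hrange : LinearMap.range (LinearMap.toSpanSingleton A A a) = I := by
      rw [h, LinearMap.range_toSpanSingleton]
    let e : A ≃ₗ[A] I := (LinearEquiv.ofInjective _ hinj).trans (LinearEquiv.ofEq _ _ hrange)
    rw [injectiveDimension_eq_of_iso e.toModuleIso]
    exact hI.injectiveDimension_lt_top

/-- Length one gives `mI ⊆ (a)`, so `I / aA` is killed by `m`. Length zero corresponds to `I`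
principal, which is the Gorenstein case: over a Gorenstein ring `A` itself has type one, so `I` is
proportional to `A`. -/
theorem sallyLength_eq_one_iff (hI : IsCanonicalModule A I) (ha : IsParameter a)
    (haI : a ∈ I) (h : I ^ (n + 1) = Ideal.span {a} * I ^ n) :
    sallyLength I a (n + 1) = 1 ↔ IsAGL A ∧ ¬ IsGorensteinLocalRing A := by
  have hI' := Ideal.isTypeOne_of_isCanonicalModule hI
  constructor
  · intro h1
    refine ⟨isAGL_of_maximalIdeal_mul_le hI ha.mem_nonZeroDivisors haI
      (maximalIdeal_mul_le_span_singleton ha.mem_nonZeroDivisors ha.mem_maximalIdeal haI hI'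
        (maximalIdeal_mul_le_of_sallyLength_eq_one h1)), fun hG => ?_⟩
    obtain ⟨y, -, hy⟩ := hG.isTypeOne_top.exists_mul_eq_mul hI' (one_mem _) trivial
      ha.mem_nonZeroDivisors haI
    rw [Ideal.mul_top, Ideal.span_singleton_one, Ideal.top_mul] at hy
    rw [sallyLength_eq_zero_of_eq_span_singleton ha.mem_nonZeroDivisors haI h hy.symm] at h1
    exact zero_ne_one h1
  · rintro ⟨hA, hG⟩
    refine le_antisymm (hA.sallyLength_le_one hI' ha haI
      (Ideal.pow_succ_eq_span_singleton_mul_of_le h (by omega))) ?_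
    rw [Order.one_le_iff_ne_zero]
    exact fun h0 => hG (isGorensteinLocalRing_of_eq_span_singleton hI ha.mem_nonZeroDivisors
      (eq_span_singleton_of_sallyLength_eq_zero ha.mem_nonZeroDivisors ha.mem_maximalIdeal haI
        hI' h0))

end AlmostGorenstein

/-! ### Conclusion: factoring two. -/

theorem Ideal.colength_eq_one_iff {A : Type*} [CommRing A] [IsLocalRing A] {P : Ideal A} :
    P.colength = 1 ↔ P = maximalIdeal A := by
  rw [Ideal.colength, Module.length_eq_one_iff, isSimpleModule_iff_isCoatom, ← Ideal.isMaximal_def]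
  exact ⟨eq_maximalIdeal, fun h => h ▸ maximalIdeal.isMaximal A⟩

theorem ENat.mul_eq_two_iff {x y : ℕ∞} : x * y = 2 ↔ x = 1 ∧ y = 2 ∨ x = 2 ∧ y = 1 := by
  constructor
  · intro h
    induction x with
    | top =>
      rcases eq_or_ne y 0 with rfl | hy
      · simp at h
      · rw [ENat.top_mul hy] at h
        exact absurd h.symm (ENat.natCast_ne_top 2)
    | coe x =>
      induction y with
      | top =>
        rcases eq_or_ne (x : ℕ∞) 0 with hx | hx
        · simp [hx] at h
        · rw [ENat.mul_top hx] at h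
          exact absurd h.symm (ENat.natCast_ne_top 2)
      | coe y =>
        have h' : x * y = 2 := by exact_mod_cast h
        have hx : x ∣ 2 := ⟨y, h'.symm⟩
        rcases (Nat.dvd_prime Nat.prime_two).mp hx with rfl | rfl
        · left
          exact ⟨rfl, by exact_mod_cast (by omega : y = 2)⟩
        · right
          exact ⟨rfl, by exact_mod_cast (by omega : y = 1)⟩
  · rintro (⟨rfl, rfl⟩ | ⟨rfl, rfl⟩) <;> simp

theorem theorem5p2 {R : Type u} {R₁ : Type v} [CommRing R] [CommRing R₁]
    [IsOneDimCMLocalRing R] [IsOneDimCMLocalRing R₁] [Algebra R R₁]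
    [Module.Flat R R₁] [IsLocalHom (algebraMap R R₁)]
    (hR : HasReducedCanonicalIdeal R)
    (hfiber : IsGorensteinLocalRing (R₁ ⧸ (maximalIdeal R).map (algebraMap R R₁))) :
    IsTwoAGL R₁ ↔
      (IsAGL R ∧ ¬ IsGorensteinLocalRing R ∧
        Module.length R₁ (R₁ ⧸ (maximalIdeal R).map (algebraMap R R₁)) = 2) ∨
      (IsTwoAGL R ∧ (maximalIdeal R).map (algebraMap R R₁) = maximalIdeal R₁) := by
  obtain ⟨I, a, hI, ha, hle, n, h⟩ := hR
  have haI : a ∈ I := (Ideal.span_singleton_le_iff_mem _).mp hle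
  -- The exponent is raised by one because `sallyLength_eq_one_iff` needs a graded piece of positive
  -- degree.
  have h' : I ^ (n + 1 + 1) = Ideal.span {a} * I ^ (n + 1) :=
    Ideal.pow_succ_eq_span_singleton_mul_of_le h (Nat.le_succ n)
  have ha₁ := isParameter_algebraMap (B := R₁) ha
  have haI₁ : algebraMap R R₁ a ∈ I.map (algebraMap R R₁) := Ideal.mem_map_of_mem _ haI
  have hI₁ : IsCanonicalIdeal (I.map (algebraMap R R₁)) := by
    refine ⟨fun htop => (maximalIdeal.isMaximal R₁).ne_top (eq_top_iff.mpr ?_),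
      ((Ideal.isTypeOne_of_isCanonicalModule hI.isCanonicalModule).map hfiber).isCanonicalModule
        ha₁ haI₁⟩
    rw [← htop, Ideal.map_le_iff_le_comap]
    exact fun x hx => IsLocalRing.map_mem_maximalIdeal _ (le_maximalIdeal hI.ne_top hx)
  have h₁ : I.map (algebraMap R R₁) ^ (n + 1 + 1) =
      Ideal.span {algebraMap R R₁ a} * I.map (algebraMap R R₁) ^ (n + 1) := by
    rw [← Ideal.map_pow, h', Ideal.map_mul, Ideal.map_span, Set.image_singleton, Ideal.map_pow]
  rw [isTwoAGL_iff_sallyLength_eq_two hI₁ ha₁ haI₁ h₁,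
    isTwoAGL_iff_sallyLength_eq_two hI ha haI h', sallyLength_map ha haI, ENat.mul_eq_two_iff,
    sallyLength_eq_one_iff hI.isCanonicalModule ha haI h, Ideal.colength_eq_one_iff, and_assoc]
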